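/- Let $I_A,I_B,J_A,J_B,K_A,K_B$ be finite sets, let $p^0\in\Delta(K_A\times K_B)$, and for $k_A\in K_A$, $k_B\in K_B$ let $A^{k_A}\in\mathbb{R}^{I_A\times J_A}$ and $B^{k_B}\in\mathbb{R}^{I_B\times J_B}$ be payoff matrices. In the three-player infinitely repeated game $\mathcal{G}(p^0)$ a state $\kappa=(\kappa_A,\kappa_B)$ is drawn from $p^0$ and told only to player 1; at each stage $t\ge 1$ player 1 chooses $(i_A^t,i_B^t)\in I_A\times I_B$, player 2 chooses $j_A^t\in J_A$ and player 3 chooses $j_B^t\in J_B$, independently given the past, and all actions are observed. The stage payoffs are $A^{\kappa_A}_{i_A^t,j_A^t}+B^{\kappa_B}_{i_B^t,j_B^t}$ to player 1, $-A^{\kappa_A}_{i_A^t,j_A^t}$ to player 2 and $-B^{\kappa_B}_{i_B^t,j_B^t}$ to player 3. A behavior strategy $\sigma$ of player 1 assigns to each state and each finite history of action profiles an element of $\Delta(I_A\times I_B)$; behavior strategies $\tau_A,\tau_B$ of players 2 and 3 assign to each finite history an element of $\Delta(J_A)$, resp. $\Delta(J_B)$. Let $\mathbb{P}=\mathbb{P}_{\sigma,\tau_A,\tau_B,p^0}$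 be the induced probability on $(I_A\times I_B\times J_A\times J_B)^{\infty}\times K_A\times K_B$, let $\alpha^{k_A,k_B}_T$ be the expected average payoff of player 1 over the first $T$ stages in state $(k_A,k_B)$, and let $\beta^A_T,\beta^B_T$ be the expected average payoffs of players 2 and 3 over the first $T$ stages. A profile $(\sigma,\tau_A,\tau_B)$ is a uniform equilibrium of $\mathcal{G}(p^0)$ if (1) $\alpha_T^{k_A,k_B}$ converges to some $\alpha^{k_A,k_B}$ for every $(k_A,k_B)\in\mathrm{supp}(p^0)$, and $\beta^A_T$ and $\beta^B_T$ converge, as $T\to\infty$; and (2) for every $\varepsilon>0$ there is a positive integer $T_0$ such that for all $T\ge T_0$ no strategy of player 1 increases $\alpha_T^{k_A,k_B}$ by more than $\varepsilon$ for any $(k_A,k_B)\in\mathrm{supp}(p^0)$, no strategy of player 2 increases $\beta^A_T$ by more than $\varepsilon$, and no strategy of player 3 increases $\beta^B_T$ by more than $\varepsilon$. It pays $\sum_{k\in\mathrm{supp}(p^0)}p^0(k)\,\alpha^{k}$ ex ante to the informed player 1. Let $v_A(q)=\min_{y\in\Delta(J_A)}\max_{x\in\Delta(I_A)}x\big(\sum_{k}q^{k}A^{k}\big)y$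 for $q\in\Delta(K_A)$, define $v_B$ on $\Delta(K_B)$ in the same way from $B$, and let $\mathrm{Cav}(v_\ell)$ be the pointwise smallest concave function on $\Delta(K_\ell)$ that is $\ge v_\ell$. For $t\ge 1$ let $\mathcal{H}_t$ be the field generated by the action profiles of the first $t-1$ stages, let $p_t=\big(\mathbb{P}(\kappa=(k_A,k_B)\mid\mathcal{H}_t)\big)_{(k_A,k_B)}$ be the martingale of posteriors, and write $p_{tA},p_{tB}$ for the marginals of $p_t$ on $K_A,K_B$, and $p^0_A,p^0_B$ for those of $p^0$. **Theorem.** Let $(\sigma,\tau_A,\tau_B)$ be a uniform equilibrium of $\mathcal{G}(p^0)$ that pays ex ante $\mathrm{Cav}(v_A)(p^0_A)+\mathrm{Cav}(v_B)(p^0_B)$ to the informed player. Then for each $\ell\in\{A,B\}$ the process $\big(\mathrm{Cav}(v_\ell)(p_{t\ell})\big)_{t\ge 1}$ is a martingale with respect to $(\mathcal{H}_t)_{t\ge 1}$ under $\mathbb{P}$. -/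

import Mathlib

open MeasureTheory ProbabilityTheory Filter Topology

namespace InfoSpillover

noncomputable section

/-! ### One-shot values and concavification -/

/-- The non-revealing value `v_M(p) = min_{y ∈ Δ(J)} max_{x ∈ Δ(I)} x M(p) y`,
where `M(p) = ∑ k, p k • M k`. -/
def nonRevealingValue {I J K : Type*} [Fintype I] [Fintype J] [Fintype K]
    (M : K → I → J → ℝ) (p : K → ℝ) : ℝ :=
  ⨅ y : stdSimplex ℝ J, ⨆ x : stdSimplex ℝ I,
    ∑ i, ∑ j, x.1 i * (∑ k, p k * M k i j) * y.1 j

/-- `Cav f` is the pointwise smallest concave function on the simplex `Δ(K)` that lies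
above `f` there: at `q` it is the infimum of `g q` over all concave majorants `g` of `f`
on `Δ(K)`.  It is only meaningful at points `q ∈ Δ(K)`. -/
def Cav {K : Type*} [Fintype K] (f : (K → ℝ) → ℝ) (q : K → ℝ) : ℝ :=
  sInf {r : ℝ | ∃ g : (K → ℝ) → ℝ, ConcaveOn ℝ (stdSimplex ℝ K) g ∧
    (∀ x ∈ stdSimplex ℝ K, f x ≤ g x) ∧ g q = r}

/-- Marginal on the first factor of a vector indexed by a product. -/
def margA {KA KB : Type*} [Fintype KB] (p : KA × KB → ℝ) (a : KA) : ℝ := ∑ b, p (a, b)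

/-- Marginal on the second factor of a vector indexed by a product. -/
def margB {KA KB : Type*} [Fintype KA] (p : KA × KB → ℝ) (b : KB) : ℝ := ∑ a, p (a, b)

/-! ### The game, histories and strategies -/

/-- The data of the three-player game: the payoff matrices `A^{k_A}`, `B^{k_B}` and the prior
`p⁰` on the set of states `K_A × K_B`. -/
structure Game (IA IB JA JB KA KB : Type*) where
  A : KA → IA → JA → ℝ
  B : KB → IB → JB → ℝ
  prior : PMF (KA × KB)

/-- Action profiles `((i_A, i_B), (j_A, j_B))` of a stage. -/
abbrev Act (IA IB JA JB : Type*) := (IA × IB) × (JA × JB)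

/-- Histories of the first `t` stages. -/
abbrev Hist (IA IB JA JB : Type*) (t : ℕ) := Fin t → Act IA IB JA JB

/-- Behaviour strategies of a player who chooses lotteries on `X` as a function of the past
action profiles; the value at `t` is the lottery used after `t` stages have been played. -/
abbrev Strategy (IA IB JA JB X : Type*) := (t : ℕ) → Hist IA IB JA JB t → PMF X

/-- Behaviour strategies of the informed player: one for each state. -/
abbrev InformedStrategy (IA IB JA JB KA KB : Type*) :=
  KA × KB → Strategy IA IB JA JB (IA × IB)

/-- The sample space `Ω = H_∞ × K_A × K_B` of infinite plays and states. -/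
abbrev Outcome (IA IB JA JB KA KB : Type*) := (ℕ → Act IA IB JA JB) × (KA × KB)

section Measures

variable {IA IB JA JB KA KB : Type*}
  [Fintype IA] [MeasurableSpace IA] [DiscreteMeasurableSpace IA]
  [Fintype IB] [MeasurableSpace IB] [DiscreteMeasurableSpace IB]
  [Fintype JA] [MeasurableSpace JA] [DiscreteMeasurableSpace JA]
  [Fintype JB] [MeasurableSpace JB] [DiscreteMeasurableSpace JB]
  [Fintype KA] [MeasurableSpace KA] [DiscreteMeasurableSpace KA]
  [Fintype KB] [MeasurableSpace KB] [DiscreteMeasurableSpace KB]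

/-- The law of the next action profile after the history `h`: the three players randomize
independently. -/
def stageLaw (s : Strategy IA IB JA JB (IA × IB)) (τA : Strategy IA IB JA JB JA)
    (τB : Strategy IA IB JA JB JB) (t : ℕ) (h : Hist IA IB JA JB t) : PMF (Act IA IB JA JB) :=
  (s t h).bind fun i => (τA t h).bind fun jA => (τB t h).map fun jB => (i, (jA, jB))

/-- The stage laws as a Markov kernel from the plays of the stages `0, …, n` to the action
profile of stage `n + 1`. -/
def stageKernel (s : Strategy IA IB JA JB (IA × IB)) (τA : Strategy IA IB JA JB JA)
    (τB : Strategy IA IB JA JB JB) (n : ℕ) :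
    Kernel (Finset.Iic n → Act IA IB JA JB) (Act IA IB JA JB) :=
  Kernel.ofFunOfCountable fun h =>
    (stageLaw s τA τB (n + 1)
      fun i => h ⟨i, Finset.mem_Iic.mpr (Nat.lt_succ_iff.mp i.isLt)⟩).toMeasure

instance (s : Strategy IA IB JA JB (IA × IB)) (τA : Strategy IA IB JA JB JA)
    (τB : Strategy IA IB JA JB JB) (n : ℕ) : IsMarkovKernel (stageKernel s τA τB n) :=
  ⟨fun _ => PMF.toMeasure.isProbabilityMeasure _⟩

/-- The law of the infinite play when player 1 uses `s` and players 2 and 3 use `τA`, `τB`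
(the play of stage `t + 1` is the coordinate `t`). -/
def playLaw (s : Strategy IA IB JA JB (IA × IB)) (τA : Strategy IA IB JA JB JA)
    (τB : Strategy IA IB JA JB JB) : Measure (ℕ → Act IA IB JA JB) :=
  Kernel.trajMeasure (X := fun _ => Act IA IB JA JB)
    (stageLaw s τA τB 0 Fin.elim0).toMeasure (stageKernel s τA τB)

instance (s : Strategy IA IB JA JB (IA × IB)) (τA : Strategy IA IB JA JB JA)
    (τB : Strategy IA IB JA JB JB) : IsProbabilityMeasure (playLaw s τA τB) := by
  have : IsProbabilityMeasure (stageLaw s τA τB 0 Fin.elim0).toMeasure :=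
    PMF.toMeasure.isProbabilityMeasure _
  unfold playLaw
  infer_instance

/-- The probability `ℙ_{σ, τ_A, τ_B, p⁰}` on `Ω`. -/
def outcomeLaw (G : Game IA IB JA JB KA KB) (σ : InformedStrategy IA IB JA JB KA KB)
    (τA : Strategy IA IB JA JB JA) (τB : Strategy IA IB JA JB JB) :
    Measure (Outcome IA IB JA JB KA KB) :=
  ∑ k, G.prior k • (playLaw (σ k) τA τB).prod (Measure.dirac k)

instance (G : Game IA IB JA JB KA KB) (σ : InformedStrategy IA IB JA JB KA KB)
    (τA : Strategy IA IB JA JB JA) (τB : Strategy IA IB JA JB JB) :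
    IsProbabilityMeasure (outcomeLaw G σ τA τB) := by
  constructor
  have h := G.prior.tsum_coe
  rw [tsum_fintype] at h
  simpa [outcomeLaw] using h

/-! ### Payoffs and uniform equilibrium -/

/-- `α_T^k`: expected average payoff of player 1 over the first `T` stages in state `k`. -/
def alphaAvg (G : Game IA IB JA JB KA KB) (T : ℕ) (k : KA × KB)
    (σ : InformedStrategy IA IB JA JB KA KB)
    (τA : Strategy IA IB JA JB JA) (τB : Strategy IA IB JA JB JB) : ℝ :=
  ∫ ω, (1 / (T : ℝ)) * ∑ t ∈ Finset.range T,
    (G.A k.1 (ω t).1.1 (ω t).2.1 + G.B k.2 (ω t).1.2 (ω t).2.2) ∂(playLaw (σ k) τA τB)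

/-- `β^A_T`: expected average payoff of player 2 over the first `T` stages. -/
def betaAvgA (G : Game IA IB JA JB KA KB) (T : ℕ) (σ : InformedStrategy IA IB JA JB KA KB)
    (τA : Strategy IA IB JA JB JA) (τB : Strategy IA IB JA JB JB) : ℝ :=
  ∫ ω, (1 / (T : ℝ)) * ∑ t ∈ Finset.range T,
    (-G.A ω.2.1 (ω.1 t).1.1 (ω.1 t).2.1) ∂(outcomeLaw G σ τA τB)

/-- `β^B_T`: expected average payoff of player 3 over the first `T` stages. -/
def betaAvgB (G : Game IA IB JA JB KA KB) (T : ℕ) (σ : InformedStrategy IA IB JA JB KA KB)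
    (τA : Strategy IA IB JA JB JA) (τB : Strategy IA IB JA JB JB) : ℝ :=
  ∫ ω, (1 / (T : ℝ)) * ∑ t ∈ Finset.range T,
    (-G.B ω.2.2 (ω.1 t).1.2 (ω.1 t).2.2) ∂(outcomeLaw G σ τA τB)

/-- `(α, β^A, β^B)` is the vector of limit payoffs of the profile `(σ, τ_A, τ_B)`; the limit
for player 1 is only required in the states of the support of the prior. -/
def HasPayoffs (G : Game IA IB JA JB KA KB) (σ : InformedStrategy IA IB JA JB KA KB)
    (τA : Strategy IA IB JA JB JA) (τB : Strategy IA IB JA JB JB)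
    (α : KA × KB → ℝ) (βA βB : ℝ) : Prop :=
  (∀ k ∈ G.prior.support, Tendsto (fun T => alphaAvg G T k σ τA τB) atTop (𝓝 (α k))) ∧
  Tendsto (fun T => betaAvgA G T σ τA τB) atTop (𝓝 βA) ∧
  Tendsto (fun T => betaAvgB G T σ τA τB) atTop (𝓝 βB)

/-- Uniform equilibrium of the game `𝒢(p⁰)`. -/
structure IsUniformEquilibrium (G : Game IA IB JA JB KA KB)
    (σ : InformedStrategy IA IB JA JB KA KB)
    (τA : Strategy IA IB JA JB JA) (τB : Strategy IA IB JA JB JB) : Prop where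
  converges : ∃ α βA βB, HasPayoffs G σ τA τB α βA βB
  epsilon_nash : ∀ ε > 0, ∃ T₀ : ℕ, 0 < T₀ ∧ ∀ T ≥ T₀,
    (∀ k ∈ G.prior.support, ∀ σ' : InformedStrategy IA IB JA JB KA KB,
      alphaAvg G T k σ' τA τB ≤ alphaAvg G T k σ τA τB + ε) ∧
    (∀ τA' : Strategy IA IB JA JB JA,
      betaAvgA G T σ τA' τB ≤ betaAvgA G T σ τA τB + ε) ∧
    (∀ τB' : Strategy IA IB JA JB JB,
      betaAvgB G T σ τA τB' ≤ betaAvgB G T σ τA τB + ε)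

/-- The prior as a vector of real numbers. -/
def priorVec (G : Game IA IB JA JB KA KB) (k : KA × KB) : ℝ := (G.prior k).toReal

/-- The profile pays `c` ex ante to the informed player: `α · p⁰ = c` for its limit payoffs. -/
def PaysExAnte (G : Game IA IB JA JB KA KB) (σ : InformedStrategy IA IB JA JB KA KB)
    (τA : Strategy IA IB JA JB JA) (τB : Strategy IA IB JA JB JB) (c : ℝ) : Prop :=
  ∃ α βA βB, HasPayoffs G σ τA τB α βA βB ∧ ∑ k, priorVec G k * α k = c

/-! ### The martingale of posteriors -/

/-- The filtration on `Ω` generated by the plays: the `t`-th σ-algebra is the finite field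
generated by the action profiles of the first `t` stages (so it is trivial for `t = 0`). -/
def histFiltration (IA IB JA JB KA KB : Type*)
    [MeasurableSpace IA] [MeasurableSpace IB] [MeasurableSpace JA] [MeasurableSpace JB]
    [MeasurableSpace KA] [MeasurableSpace KB] :
    Filtration ℕ (inferInstance : MeasurableSpace (Outcome IA IB JA JB KA KB)) where
  seq t := MeasurableSpace.comap
    (fun (ω : Outcome IA IB JA JB KA KB) (i : Fin t) => ω.1 i) inferInstance
  mono' := by
    intro s t hst
    have h : Measurable
        (fun (x : Hist IA IB JA JB t) (i : Fin s) => x (Fin.castLE hst i)) := by fun_prop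
    rintro _ ⟨S, hS, rfl⟩
    exact ⟨_, h hS, rfl⟩
  le' := by
    intro t
    apply Measurable.comap_le
    fun_prop

/-- The posterior `p_t^k = ℙ(κ = k | ℋ_t)` of the state after `t` stages. -/
def posterior (G : Game IA IB JA JB KA KB) (σ : InformedStrategy IA IB JA JB KA KB)
    (τA : Strategy IA IB JA JB JA) (τB : Strategy IA IB JA JB JB)
    (t : ℕ) (ω : Outcome IA IB JA JB KA KB) (k : KA × KB) : ℝ :=
  ((outcomeLaw G σ τA τB)⟦{ω' | ω'.2 = k} | histFiltration IA IB JA JB KA KB t⟧) ω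

end Measures

end

end InfoSpillover

/-! Let c_A(n) and c_B(n) be the expected values of Cav(v_A) and Cav(v_B) at the marginal posteriors
after n stages (`expectedCav`). By Jensen both are nonincreasing in n (`expectedCav_succ_le`), and
at n = 0 they are the values at the marginals of the prior.

The key bound is that in equilibrium the long-run loss of each uninformed player is at most c(n),
for every n (`neg_betaA_le_expectedCav`, `neg_betaB_le_expectedCav`). Otherwise the player would
follow the equilibrium strategy for n stages and then play nearly optimally in the non-revealing
game at the current posterior, which is computed from σ alone. Against the state-averaged lottery of
the informed player each stage then costs at most v + δ ≤ Cav(v) + δ. The error made by averaging is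
controlled by the increase of a bounded quadratic functional of the posterior (`energy`), which
telescopes over the stages, so it is negligible in the long-run average
(`eventually_average_stageCost_le`).

The stage payoffs add up to zero, so the ex ante payoff of the informed player is the sum of the two
losses. By assumption it equals c_A(0) + c_B(0), so each loss equals its c(0), and both sequences
are constant. Equality of expectations in Jensen's inequality forces equality after every history of
positive probability, which is the martingale property (`martingale_Cav_posterior`).

Posteriors appear unnormalised, as state weights along a history, and functions on the simplex are
extended homogeneously (`perspective`); null histories then need little care. -/

namespace InfoSpillover

noncomputable section

/-! ### Weights of finite paths -/

section Paths

variable {X : Type*}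

/-- The product of the transition weights `f` along a finite path. -/
def pathWeight (f : (n : ℕ) → (Fin n → X) → X → ℝ) : (n : ℕ) → (Fin n → X) → ℝ
  | 0, _ => 1
  | n + 1, h => pathWeight f n (Fin.init h) * f n (Fin.init h) (h (Fin.last n))

lemma pathWeight_snoc (f : (n : ℕ) → (Fin n → X) → X → ℝ) (n : ℕ) (h : Fin n → X) (a : X) :
    pathWeight f (n + 1) (Fin.snoc h a : Fin (n + 1) → X) = pathWeight f n h * f n h a := by
  simp [pathWeight]

lemma pathWeight_nonneg {f : (n : ℕ) → (Fin n → X) → X → ℝ} (hf : ∀ n h a, 0 ≤ f n h a) :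
    ∀ (n : ℕ) (h : Fin n → X), 0 ≤ pathWeight f n h
  | 0, _ => zero_le_one
  | n + 1, _ => mul_nonneg (pathWeight_nonneg hf n _) (hf _ _ _)

lemma pathWeight_mul (f g : (n : ℕ) → (Fin n → X) → X → ℝ) :
    ∀ (n : ℕ) (h : Fin n → X),
      pathWeight (fun n h a => f n h a * g n h a) n h = pathWeight f n h * pathWeight g n h
  | 0, _ => by simp [pathWeight]
  | n + 1, h => by simp only [pathWeight, pathWeight_mul f g n]; ring

lemma pathWeight_congr {f g : (n : ℕ) → (Fin n → X) → X → ℝ} :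
    ∀ (n : ℕ), (∀ m < n, f m = g m) → pathWeight f n = pathWeight g n
  | 0, _ => rfl
  | n + 1, hfg => by
    funext h
    simp only [pathWeight]
    rw [pathWeight_congr n fun m hm => hfg m (hm.trans n.lt_succ_self), hfg n n.lt_succ_self]

lemma sum_fin_succ_eq_sum_snoc [Fintype X] {n : ℕ} (F : (Fin (n + 1) → X) → ℝ) :
    ∑ h, F h = ∑ h : Fin n → X, ∑ a, F (Fin.snoc h a : Fin (n + 1) → X) := by
  rw [← (Fin.snocEquiv fun _ : Fin (n + 1) => X).sum_comp F, Fintype.sum_prod_type,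
    Finset.sum_comm]
  rfl

end Paths

/-! ### Variation of the posteriors in one stage -/

section OneStage

variable {I K : Type*} [Fintype K]

/-- `∑ k, (u k)² / ∑ u`, the energy of the normalisation of `u` times the mass of `u`. -/
def energy (u : K → ℝ) : ℝ := ∑ k, u k ^ 2 / ∑ k', u k'

lemma energy_nonneg {u : K → ℝ} (hu : ∀ k, 0 ≤ u k) : 0 ≤ energy u :=
  Finset.sum_nonneg fun _ _ => div_nonneg (sq_nonneg _) (Finset.sum_nonneg fun k _ => hu k)

/-- Each weight is at most the total mass. Summed over histories this bounds the energy by 1 at all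
times, so its increments have a bounded total. -/
lemma energy_le_sum {u : K → ℝ} (hu : ∀ k, 0 ≤ u k) : energy u ≤ ∑ k, u k := by
  refine Finset.sum_le_sum fun k _ => ?_
  have hk : u k ≤ ∑ k', u k' := Finset.single_le_sum (fun k' _ => hu k') (Finset.mem_univ k)
  refine div_le_of_le_mul₀ ((hu k).trans hk) (hu k) ?_
  rw [sq]
  exact mul_le_mul_of_nonneg_left hk (hu k)

/-- The lottery on actions averaged over the states with weights `u`. -/
def avgAction (u : K → ℝ) (s : K → I → ℝ) (i : I) : ℝ := (∑ k, u k * s k i) / ∑ k, u k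

lemma avgAction_nonneg {u : K → ℝ} (hu : ∀ k, 0 ≤ u k) {s : K → I → ℝ} (hs : ∀ k i, 0 ≤ s k i)
    (i : I) : 0 ≤ avgAction u s i :=
  div_nonneg (Finset.sum_nonneg fun k _ => mul_nonneg (hu k) (hs k i))
    (Finset.sum_nonneg fun k _ => hu k)

lemma sum_avgAction [Fintype I] {u : K → ℝ} (hu : ∑ k, u k ≠ 0) {s : K → I → ℝ} (hs : ∀ k, ∑ i, s k i = 1) :
    ∑ i, avgAction u s i = 1 := by
  simp only [avgAction]
  rw [← Finset.sum_div, Finset.sum_comm]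
  simp only [← Finset.mul_sum, hs, mul_one]
  exact div_self hu

/-- AM–GM with a free parameter. Unlike Cauchy–Schwarz it leaves no square root, so the bound can be
summed over actions and histories: the terms m add up to mass and the terms d²/m to an energy
increment. -/
lemma abs_le_half_add_sq_div {d m η : ℝ} (hm : 0 ≤ m) (hη : 0 < η) (hd : m = 0 → d = 0) :
    |d| ≤ (η * m + d ^ 2 / m / η) / 2 := by
  rcases hm.eq_or_lt with h | h
  · simp [hd h.symm, ← h]
  · have : (η * m + d ^ 2 / m / η) / 2 - |d| = (η * m - |d|) ^ 2 / (2 * m * η) := by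
      rw [← sq_abs d]; field_simp; ring
    have : 0 ≤ (η * m - |d|) ^ 2 / (2 * m * η) := by positivity
    linarith

/-- Replacing the state-dependent lottery by its average costs at most the increase of the
energy, up to a linear term. -/
lemma sum_mul_le_avgAction [Fintype I] {u : K → ℝ} (hu : ∀ k, 0 ≤ u k) {s : K → I → ℝ}
    (hs : ∀ k i, 0 ≤ s k i) (hs1 : ∀ k, ∑ i, s k i = 1) {c : K → I → ℝ} {C η : ℝ} (hη : 0 < η)
    (hc : ∀ k i, |c k i| ≤ C) :
    ∑ k, u k * ∑ i, s k i * c k i ≤ ∑ k, u k * ∑ i, avgAction u s i * c k i +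
      C * ((η * Fintype.card K * ∑ k, u k +
        (∑ i, energy (fun k => u k * s k i) - energy u) / η) / 2) := by
  classical
  set U := ∑ k, u k with hU
  set m : I → ℝ := fun i => ∑ k, u k * s k i with hm
  have hUnn : 0 ≤ U := Finset.sum_nonneg fun k _ => hu k
  have hmnn : ∀ i, 0 ≤ m i := fun i => Finset.sum_nonneg fun k _ => mul_nonneg (hu k) (hs k i)
  have hmsum : ∑ i, m i = U := by
    simp only [hm]
    rw [Finset.sum_comm]
    simp only [← Finset.mul_sum, hs1, mul_one, hU]
  have hm0 : ∀ i, m i = 0 → ∀ k, u k * s k i = 0 := fun i hi k =>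
    (Finset.sum_eq_zero_iff_of_nonneg fun k _ => mul_nonneg (hu k) (hs k i)).1 hi k
      (Finset.mem_univ k)
  have hU0 : U = 0 → ∀ k, u k = 0 := fun h k =>
    (Finset.sum_eq_zero_iff_of_nonneg fun k _ => hu k).1 h k (Finset.mem_univ k)
  -- The deviation of the joint law of state and action from the product of its marginals. It
  -- measures what the action reveals, and its weighted square is the energy gained.
  set d : K → I → ℝ := fun k i => u k * s k i - u k / U * m i with hd
  have hdm : ∀ k i, m i = 0 → d k i = 0 := fun k i hi => by simp [hd, hm0 i hi k, hi]
  have hsq : ∀ k i, d k i ^ 2 / m i =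
      (u k * s k i) ^ 2 / m i - 2 * (u k / U) * (u k * s k i) + (u k / U) ^ 2 * m i := by
    intro k i
    rcases eq_or_ne (m i) 0 with hi | hi
    · simp [hi, hm0 i hi k]
    · simp only [hd]; field_simp; ring
  have hsqsum : ∀ k, ∑ i, d k i ^ 2 / m i = ∑ i, (u k * s k i) ^ 2 / m i - u k ^ 2 / U := by
    intro k
    simp only [hsq, Finset.sum_add_distrib, Finset.sum_sub_distrib, ← Finset.mul_sum, hs1, hmsum]
    rcases eq_or_ne U 0 with h | h
    · simp [h]
    · field_simp; ring
  have hE : ∑ k, ∑ i, d k i ^ 2 / m i = ∑ i, energy (fun k => u k * s k i) - energy u := by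
    simp only [hsqsum, Finset.sum_sub_distrib, energy]
    rw [Finset.sum_comm]
  have hdiff : ∑ k, u k * ∑ i, s k i * c k i - ∑ k, u k * ∑ i, avgAction u s i * c k i =
      ∑ k, ∑ i, d k i * c k i := by
    rw [← Finset.sum_sub_distrib]
    refine Finset.sum_congr rfl fun k _ => ?_
    rw [Finset.mul_sum, Finset.mul_sum, ← Finset.sum_sub_distrib]
    refine Finset.sum_congr rfl fun i _ => ?_
    simp only [hd, avgAction, ← hU]
    ring
  have hbound : ∑ k, ∑ i, d k i * c k i ≤
      ∑ k, ∑ i, C * ((η * m i + d k i ^ 2 / m i / η) / 2) := by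
    refine Finset.sum_le_sum fun k _ => Finset.sum_le_sum fun i _ => ?_
    have h1 := abs_le_half_add_sq_div (hmnn i) hη (hdm k i)
    calc d k i * c k i ≤ |d k i| * |c k i| := by rw [← abs_mul]; exact le_abs_self _
      _ ≤ |d k i| * C := mul_le_mul_of_nonneg_left (hc k i) (abs_nonneg _)
      _ ≤ C * ((η * m i + d k i ^ 2 / m i / η) / 2) := by
        rw [mul_comm]
        exact mul_le_mul_of_nonneg_left h1 ((abs_nonneg _).trans (hc k i))
  have hval : ∑ k, ∑ i, C * ((η * m i + d k i ^ 2 / m i / η) / 2) =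
      C * ((η * Fintype.card K * U +
        (∑ i, energy (fun k => u k * s k i) - energy u) / η) / 2) := by
    simp only [← Finset.mul_sum, ← Finset.sum_div, Finset.sum_add_distrib, hmsum]
    rw [hE]
    simp only [Finset.sum_const, Finset.card_univ, nsmul_eq_mul]
    ring
  linarith [hdiff, hbound, hval]

end OneStage

/-! ### Plays of a game with a state-dependent player against uninformed ones -/

section Tree

variable {I J K : Type*}

/-- The weight of the state `k` after the history `h`: the prior times the likelihood of the
actions of the informed player. -/
def stateWeight (p : K → ℝ) (s : K → (n : ℕ) → (Fin n → I × J) → I → ℝ) (n : ℕ)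
    (h : Fin n → I × J) (k : K) : ℝ :=
  p k * pathWeight (fun n h a => s k n h a.1) n h

/-- The likelihood of the actions of the uninformed players along the history `h`. -/
def oppWeight (y : (n : ℕ) → (Fin n → I × J) → J → ℝ) (n : ℕ) (h : Fin n → I × J) : ℝ :=
  pathWeight (fun n h a => y n h a.2) n h

/-- The sum of `Φ` of the state weights over the histories of length `n`. -/
def levelSum [Fintype I] [Fintype J] (p : K → ℝ) (s : K → (n : ℕ) → (Fin n → I × J) → I → ℝ)
    (y : (n : ℕ) → (Fin n → I × J) → J → ℝ) (Φ : (K → ℝ) → ℝ) (n : ℕ) : ℝ :=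
  ∑ h : Fin n → I × J, oppWeight y n h * Φ (stateWeight p s n h)

variable {p : K → ℝ} {s : K → (n : ℕ) → (Fin n → I × J) → I → ℝ}
  {y : (n : ℕ) → (Fin n → I × J) → J → ℝ}

lemma stateWeight_nonneg (hp : ∀ k, 0 ≤ p k) (hs : ∀ k n h i, 0 ≤ s k n h i) (n : ℕ)
    (h : Fin n → I × J) (k : K) : 0 ≤ stateWeight p s n h k :=
  mul_nonneg (hp k) (pathWeight_nonneg (fun n h a => hs k n h a.1) n h)

lemma oppWeight_nonneg (hy : ∀ n h j, 0 ≤ y n h j) (n : ℕ) (h : Fin n → I × J) :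
    0 ≤ oppWeight y n h :=
  pathWeight_nonneg (fun n h a => hy n h a.2) n h

lemma stateWeight_snoc (n : ℕ) (h : Fin n → I × J) (a : I × J) :
    stateWeight p s (n + 1) (Fin.snoc h a : Fin (n + 1) → I × J) =
      fun k => stateWeight p s n h k * s k n h a.1 := by
  funext k
  simp only [stateWeight, pathWeight_snoc]
  ring

lemma oppWeight_snoc (n : ℕ) (h : Fin n → I × J) (a : I × J) :
    oppWeight y (n + 1) (Fin.snoc h a : Fin (n + 1) → I × J) = oppWeight y n h * y n h a.2 :=
  pathWeight_snoc _ n h a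

variable [Fintype I] [Fintype J]

/-- Actions of the uninformed players carry no information on the state: the new state weights
depend on `a.1` only, so the opponents' lottery sums out. -/
lemma sum_snoc_oppWeight_mul (hy1 : ∀ n h, ∑ j, y n h j = 1) (Φ : (K → ℝ) → ℝ) (n : ℕ)
    (h : Fin n → I × J) :
    ∑ a, oppWeight y (n + 1) (Fin.snoc h a : Fin (n + 1) → I × J) *
        Φ (stateWeight p s (n + 1) (Fin.snoc h a : Fin (n + 1) → I × J)) =
      oppWeight y n h * ∑ i, Φ (fun k => stateWeight p s n h k * s k n h i) := by
  simp only [oppWeight_snoc, stateWeight_snoc, Fintype.sum_prod_type]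
  rw [Finset.mul_sum]
  refine Finset.sum_congr rfl fun i _ => ?_
  rw [← Finset.sum_mul, ← Finset.mul_sum, hy1, mul_one]

lemma levelSum_succ (hy1 : ∀ n h, ∑ j, y n h j = 1) (Φ : (K → ℝ) → ℝ) (n : ℕ) :
    levelSum p s y Φ (n + 1) = ∑ h : Fin n → I × J,
      oppWeight y n h * ∑ i, Φ (fun k => stateWeight p s n h k * s k n h i) := by
  rw [levelSum, sum_fin_succ_eq_sum_snoc]
  exact Finset.sum_congr rfl fun h _ => sum_snoc_oppWeight_mul hy1 Φ n h

lemma levelSum_succ_le (hp : ∀ k, 0 ≤ p k) (hs : ∀ k n h i, 0 ≤ s k n h i)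
    (hs1 : ∀ k n h, ∑ i, s k n h i = 1)
    (hy : ∀ n h j, 0 ≤ y n h j) (hy1 : ∀ n h, ∑ j, y n h j = 1) {Φ : (K → ℝ) → ℝ}
    (hΦ : ∀ (u : K → ℝ) (t : K → I → ℝ), (∀ k, 0 ≤ u k) → (∀ k i, 0 ≤ t k i) →
      (∀ k, ∑ i, t k i = 1) → ∑ i, Φ (fun k => u k * t k i) ≤ Φ u) (n : ℕ) :
    levelSum p s y Φ (n + 1) ≤ levelSum p s y Φ n := by
  rw [levelSum_succ hy1]
  exact Finset.sum_le_sum fun h _ => mul_le_mul_of_nonneg_left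
    (hΦ _ _ (stateWeight_nonneg hp hs n h) (fun k i => hs k n h i) fun k => hs1 k n h)
    (oppWeight_nonneg hy n h)

lemma levelSum_sum [Fintype K] (hs1 : ∀ k n h, ∑ i, s k n h i = 1)
    (hy1 : ∀ n h, ∑ j, y n h j = 1) (n : ℕ) :
    levelSum p s y (fun u => ∑ k, u k) n = ∑ k, p k := by
  induction n with
  | zero => simp [levelSum, oppWeight, stateWeight, pathWeight]
  | succ n ih =>
    rw [levelSum_succ hy1, ← ih, levelSum]
    refine Finset.sum_congr rfl fun h _ => ?_
    rw [Finset.sum_comm]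
    simp only [← Finset.mul_sum, hs1, mul_one]

/-- The expected cost `N` of stage `n`. -/
def stageCost [Fintype K] (p : K → ℝ) (s : K → (n : ℕ) → (Fin n → I × J) → I → ℝ)
    (y : (n : ℕ) → (Fin n → I × J) → J → ℝ) (N : K → I → J → ℝ) (n : ℕ) : ℝ :=
  ∑ h : Fin n → I × J, oppWeight y n h *
    ∑ k, stateWeight p s n h k * ∑ i, s k n h i * ∑ j, y n h j * N k i j

variable [Fintype K]

/-- `sum_mul_le_avgAction` is applied at each history; after summation the energy gains become the
difference of two consecutive levels. -/
lemma stageCost_le (hp : ∀ k, 0 ≤ p k) (hp1 : ∑ k, p k = 1) (hs : ∀ k n h i, 0 ≤ s k n h i)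
    (hs1 : ∀ k n h, ∑ i, s k n h i = 1)
    (hy : ∀ n h j, 0 ≤ y n h j) (hy1 : ∀ n h, ∑ j, y n h j = 1) {Φ : (K → ℝ) → ℝ}
    {N : K → I → J → ℝ} {C δ η : ℝ} (hη : 0 < η) (hN : ∀ k i j, |N k i j| ≤ C) (n : ℕ)
    (hopt : ∀ h : Fin n → I × J, ∑ k, stateWeight p s n h k *
      ∑ i, avgAction (stateWeight p s n h) (fun k => s k n h) i * ∑ j, y n h j * N k i j ≤
        Φ (stateWeight p s n h) + δ * ∑ k, stateWeight p s n h k) :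
    stageCost p s y N n ≤ levelSum p s y Φ n + δ +
      C * ((η * Fintype.card K +
        (levelSum p s y energy (n + 1) - levelSum p s y energy n) / η) / 2) := by
  have hc : ∀ h : Fin n → I × J, ∀ k i, |∑ j, y n h j * N k i j| ≤ C := by
    intro h k i
    calc |∑ j, y n h j * N k i j| ≤ ∑ j, |y n h j * N k i j| := Finset.abs_sum_le_sum_abs _ _
      _ ≤ ∑ j, y n h j * C := Finset.sum_le_sum fun j _ => by
        rw [abs_mul, abs_of_nonneg (hy n h j)]
        exact mul_le_mul_of_nonneg_left (hN k i j) (hy n h j)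
      _ = C := by rw [← Finset.sum_mul, hy1, one_mul]
  have hone := levelSum_sum (p := p) hs1 hy1 n
  calc stageCost p s y N n
      ≤ ∑ h : Fin n → I × J, oppWeight y n h * (Φ (stateWeight p s n h) +
          δ * ∑ k, stateWeight p s n h k +
          C * ((η * Fintype.card K * ∑ k, stateWeight p s n h k +
            (∑ i, energy (fun k => stateWeight p s n h k * s k n h i) -
              energy (stateWeight p s n h)) / η) / 2)) := by
        refine Finset.sum_le_sum fun h _ =>
          mul_le_mul_of_nonneg_left ?_ (oppWeight_nonneg hy n h)
        have := sum_mul_le_avgAction (stateWeight_nonneg hp hs n h) (fun k i => hs k n h i)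
          (fun k => hs1 k n h) hη (hc h)
        linarith [hopt h]
    _ = levelSum p s y Φ n + δ * levelSum p s y (fun u => ∑ k, u k) n +
      C * ((η * Fintype.card K * levelSum p s y (fun u => ∑ k, u k) n +
        (levelSum p s y energy (n + 1) - levelSum p s y energy n) / η) / 2) := by
        rw [levelSum_succ hy1]
        simp only [levelSum, Finset.mul_sum, Finset.sum_div, ← Finset.sum_sub_distrib,
          ← Finset.sum_add_distrib]
        refine Finset.sum_congr rfl fun h _ => ?_
        simp only [← Finset.mul_sum]
        ring
    _ = _ := by rw [hone, hp1, mul_one, mul_one]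

/-- If from stage `t₀` on the uninformed players keep the cost against the average lottery
below `Φ`, the long-run average cost is at most the level of `Φ` at `t₀`. -/
lemma eventually_average_stageCost_le (hp : ∀ k, 0 ≤ p k) (hp1 : ∑ k, p k = 1)
    (hs : ∀ k n h i, 0 ≤ s k n h i) (hs1 : ∀ k n h, ∑ i, s k n h i = 1)
    (hy : ∀ n h j, 0 ≤ y n h j) (hy1 : ∀ n h, ∑ j, y n h j = 1) {Φ : (K → ℝ) → ℝ}
    (hΦ : ∀ (u : K → ℝ) (t : K → I → ℝ), (∀ k, 0 ≤ u k) → (∀ k i, 0 ≤ t k i) →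
      (∀ k, ∑ i, t k i = 1) → ∑ i, Φ (fun k => u k * t k i) ≤ Φ u)
    (N : K → I → J → ℝ) {δ : ℝ} (hδ : 0 < δ) (t₀ : ℕ)
    (hopt : ∀ n ≥ t₀, ∀ h : Fin n → I × J, ∑ k, stateWeight p s n h k *
      ∑ i, avgAction (stateWeight p s n h) (fun k => s k n h) i * ∑ j, y n h j * N k i j ≤
        Φ (stateWeight p s n h) + δ * ∑ k, stateWeight p s n h k) :
    ∀ᶠ T : ℕ in atTop, 1 / (T : ℝ) * ∑ t ∈ Finset.range T, stageCost p s y N t ≤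
      levelSum p s y Φ t₀ + 3 * δ := by
  obtain ⟨C, hC0, hN⟩ : ∃ C : ℝ, 0 < C ∧ ∀ k i j, |N k i j| ≤ C := by
    obtain ⟨C, hC⟩ := (Set.finite_range fun x : K × I × J => |N x.1 x.2.1 x.2.2|).bddAbove
    -- A strictly positive bound is needed because η is defined by dividing by it.
    exact ⟨max C 1, by positivity,
      fun k i j => (hC ⟨(k, i, j), rfl⟩).trans (le_max_left _ _)⟩
  have hanti : ∀ n ≥ t₀, levelSum p s y Φ n ≤ levelSum p s y Φ t₀ := fun n hn =>
    antitone_nat_of_succ_le (levelSum_succ_le hp hs hs1 hy hy1 hΦ) hn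
  -- Chosen so that the part of the averaging error proportional to η costs at most δ per stage; the
  -- `+ 1` keeps the denominator positive.
  set η : ℝ := 2 * δ / (C * (Fintype.card K + 1)) with hηdef
  have hη : 0 < η := by positivity
  have hηC : C * (η * Fintype.card K / 2) ≤ δ := by
    rw [hηdef]
    have : C * (2 * δ / (C * (Fintype.card K + 1)) * Fintype.card K / 2) =
        δ * (Fintype.card K / (Fintype.card K + 1)) := by field_simp
    rw [this]
    refine mul_le_of_le_one_right hδ.le ?_
    rw [div_le_one (by positivity)]
    linarith
  set V := levelSum p s y energy with hV
  set L := levelSum p s y Φ t₀ with hL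
  have hV0 : ∀ n, 0 ≤ V n := fun n => Finset.sum_nonneg fun h _ =>
    mul_nonneg (oppWeight_nonneg hy n h) (energy_nonneg (stateWeight_nonneg hp hs n h))
  have hV1 : ∀ n, V n ≤ 1 := fun n => by
    rw [← hp1, ← levelSum_sum (p := p) hs1 hy1 n]
    exact Finset.sum_le_sum fun h _ => mul_le_mul_of_nonneg_left
      (energy_le_sum (stateWeight_nonneg hp hs n h)) (oppWeight_nonneg hy n h)
  set S := ∑ t ∈ Finset.range t₀, stageCost p s y N t with hS
  -- Each stage from t₀ on costs at most L + 2δ (one δ from near-optimality, one from η) plus a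
  -- multiple of the energy increment, which telescopes.
  have hsum : ∀ T ≥ t₀, ∑ t ∈ Finset.range T, stageCost p s y N t ≤
      S + ((T : ℝ) - t₀) * (L + 2 * δ) + C / (2 * η) * (V T - V t₀) := by
    intro T hT
    induction T, hT using Nat.le_induction with
    | base => simp [hS]
    | succ T hT ih =>
      rw [Finset.sum_range_succ]
      have h1 := stageCost_le hp hp1 hs hs1 hy hy1 hη hN T (hopt T hT)
      have h2 := hanti T hT
      have h3 : C * ((η * Fintype.card K + (V (T + 1) - V T) / η) / 2) =
          C * (η * Fintype.card K / 2) + C / (2 * η) * (V (T + 1) - V T) := by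
        field_simp
      rw [h3] at h1
      push_cast
      nlinarith [h1, h2, ih, hηC]
  -- Collects everything that does not grow with T: the first t₀ stages and the total energy gain,
  -- at most 1. Divided by T it drops below the third δ.
  set D := S - t₀ * (L + 2 * δ) + C / (2 * η) with hD
  have hlim : Tendsto (fun T : ℕ => D * (1 / (T : ℝ))) atTop (𝓝 0) := by
    simpa using tendsto_one_div_atTop_nhds_zero_nat.const_mul D
  filter_upwards [hlim.eventually (gt_mem_nhds hδ), eventually_ge_atTop t₀,
    eventually_gt_atTop 0] with T hT1 hT2 hT3
  have hTpos : (0 : ℝ) < T := by exact_mod_cast hT3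
  have h1 : ∑ t ∈ Finset.range T, stageCost p s y N t ≤ D + T * (L + 2 * δ) := by
    have h2 := hsum T hT2
    have h3 : C / (2 * η) * (V T - V t₀) ≤ C / (2 * η) * 1 :=
      mul_le_mul_of_nonneg_left (by linarith [hV0 t₀, hV1 T]) (by positivity)
    rw [hD]
    linarith
  calc 1 / (T : ℝ) * ∑ t ∈ Finset.range T, stageCost p s y N t
      ≤ 1 / (T : ℝ) * (D + T * (L + 2 * δ)) := mul_le_mul_of_nonneg_left h1 (by positivity)
    _ = D * (1 / (T : ℝ)) + (L + 2 * δ) := by field_simp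
    _ ≤ L + 3 * δ := by linarith

end Tree

/-! ### Concavification and the non-revealing value -/

section Concavification

variable {I J K : Type*} [Fintype I] [Fintype J] [Fintype K]

lemma abs_sum_mul_le_of_abs_le {x a : I → ℝ} (hx : x ∈ stdSimplex ℝ I) {C : ℝ}
    (ha : ∀ i, |a i| ≤ C) : |∑ i, x i * a i| ≤ C :=
  calc |∑ i, x i * a i| ≤ ∑ i, |x i * a i| := Finset.abs_sum_le_sum_abs _ _
    _ ≤ ∑ i, x i * C := Finset.sum_le_sum fun i _ => by
      rw [abs_mul, abs_of_nonneg (hx.1 i)]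
      exact mul_le_mul_of_nonneg_left (ha i) (hx.1 i)
    _ = C := by rw [← Finset.sum_mul, hx.2, one_mul]

lemma abs_bilinear_le {M : K → I → J → ℝ} {C : ℝ} (hM : ∀ k i j, |M k i j| ≤ C) {p : K → ℝ}
    (hp : p ∈ stdSimplex ℝ K) (x : stdSimplex ℝ I) (y : stdSimplex ℝ J) :
    |∑ i, ∑ j, x.1 i * (∑ k, p k * M k i j) * y.1 j| ≤ C := by
  have : ∀ i, ∑ j, x.1 i * (∑ k, p k * M k i j) * y.1 j =
      x.1 i * ∑ j, y.1 j * ∑ k, p k * M k i j := fun i => by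
    rw [Finset.mul_sum]
    exact Finset.sum_congr rfl fun j _ => by ring
  simp only [this]
  exact abs_sum_mul_le_of_abs_le x.2 fun i => abs_sum_mul_le_of_abs_le y.2 fun j =>
    abs_sum_mul_le_of_abs_le hp fun k => hM k i j

lemma exists_forall_abs_le (M : K → I → J → ℝ) : ∃ C, ∀ k i j, |M k i j| ≤ C := by
  obtain ⟨C, hC⟩ := (Set.finite_range fun x : K × I × J => |M x.1 x.2.1 x.2.2|).bddAbove
  exact ⟨C, fun k i j => hC ⟨(k, i, j), rfl⟩⟩

/-- A nearly optimal lottery of the minimiser in the non-revealing game. -/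
lemma exists_forall_bilinear_le_nonRevealingValue_add [Nonempty J] (M : K → I → J → ℝ) {p : K → ℝ}
    (hp : p ∈ stdSimplex ℝ K) {δ : ℝ} (hδ : 0 < δ) :
    ∃ y : stdSimplex ℝ J, ∀ x : stdSimplex ℝ I,
      ∑ i, ∑ j, x.1 i * (∑ k, p k * M k i j) * y.1 j ≤ nonRevealingValue M p + δ := by
  classical
  obtain ⟨C, hC⟩ := exists_forall_abs_le M
  have : Nonempty (stdSimplex ℝ J) := ⟨⟨_, single_mem_stdSimplex ℝ (Classical.arbitrary J)⟩⟩
  obtain ⟨y, hy⟩ := exists_lt_of_ciInf_lt (lt_add_of_pos_right (nonRevealingValue M p) hδ)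
  refine ⟨y, fun x => (le_ciSup (f := fun x : stdSimplex ℝ I =>
    ∑ i, ∑ j, x.1 i * (∑ k, p k * M k i j) * y.1 j) ?_ x).trans hy.le⟩
  refine ⟨C, ?_⟩
  rintro _ ⟨x, rfl⟩
  exact (abs_le.1 (abs_bilinear_le hC hp x y)).2

/-- An upper bound provides a constant concave majorant, so that the infimum defining `Cav` is over
a nonempty set and not the default value of `sInf`. -/
lemma exists_nonRevealingValue_le [Nonempty I] [Nonempty J] (M : K → I → J → ℝ) :
    ∃ C, ∀ p ∈ stdSimplex ℝ K, nonRevealingValue M p ≤ C := by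
  classical
  obtain ⟨C, hC⟩ := exists_forall_abs_le M
  have : Nonempty (stdSimplex ℝ J) := ⟨⟨_, single_mem_stdSimplex ℝ (Classical.arbitrary J)⟩⟩
  have : Nonempty (stdSimplex ℝ I) := ⟨⟨_, single_mem_stdSimplex ℝ (Classical.arbitrary I)⟩⟩
  refine ⟨C, fun p hp => ?_⟩
  have hbdd : ∀ y : stdSimplex ℝ J, BddAbove (Set.range fun x : stdSimplex ℝ I =>
      ∑ i, ∑ j, x.1 i * (∑ k, p k * M k i j) * y.1 j) := by
    rintro y
    refine ⟨C, ?_⟩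
    rintro _ ⟨x, rfl⟩
    exact (abs_le.1 (abs_bilinear_le hC hp x y)).2
  refine (ciInf_le ?_ (Classical.arbitrary (stdSimplex ℝ J))).trans
    (ciSup_le fun x => (abs_le.1 (abs_bilinear_le hC hp x _)).2)
  refine ⟨-C, ?_⟩
  rintro _ ⟨y, rfl⟩
  exact (abs_le.1 (abs_bilinear_le hC hp (Classical.arbitrary (stdSimplex ℝ I)) y)).1.trans
    (le_ciSup (hbdd y) (Classical.arbitrary (stdSimplex ℝ I)))

lemma Cav_nonempty {f : (K → ℝ) → ℝ} {C : ℝ} (hf : ∀ q ∈ stdSimplex ℝ K, f q ≤ C) (q : K → ℝ) :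
    {r : ℝ | ∃ g : (K → ℝ) → ℝ, ConcaveOn ℝ (stdSimplex ℝ K) g ∧
      (∀ x ∈ stdSimplex ℝ K, f x ≤ g x) ∧ g q = r}.Nonempty :=
  ⟨C, fun _ => C, concaveOn_const C (convex_stdSimplex ℝ K), hf, rfl⟩

lemma le_Cav {f : (K → ℝ) → ℝ} {C : ℝ} (hf : ∀ q ∈ stdSimplex ℝ K, f q ≤ C) {q : K → ℝ}
    (hq : q ∈ stdSimplex ℝ K) : f q ≤ Cav f q := by
  refine le_csInf (Cav_nonempty hf q) ?_
  rintro _ ⟨g, -, hg, rfl⟩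
  exact hg q hq

lemma Cav_le {f g : (K → ℝ) → ℝ} (hg : ConcaveOn ℝ (stdSimplex ℝ K) g)
    (hfg : ∀ x ∈ stdSimplex ℝ K, f x ≤ g x) {q : K → ℝ} (hq : q ∈ stdSimplex ℝ K) :
    Cav f q ≤ g q := by
  refine csInf_le ⟨f q, ?_⟩ ⟨g, hg, hfg, rfl⟩
  rintro _ ⟨g, -, hg, rfl⟩
  exact hg q hq

/-- A pointwise infimum of concave functions is concave. -/
lemma concaveOn_Cav {f : (K → ℝ) → ℝ} {C : ℝ} (hf : ∀ q ∈ stdSimplex ℝ K, f q ≤ C) :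
    ConcaveOn ℝ (stdSimplex ℝ K) (Cav f) := by
  refine ⟨convex_stdSimplex ℝ K, fun x hx y hy a b ha hb hab => ?_⟩
  refine le_csInf (Cav_nonempty hf _) ?_
  rintro _ ⟨g, hg, hfg, rfl⟩
  refine le_trans ?_ (hg.2 hx hy ha hb hab)
  exact add_le_add (mul_le_mul_of_nonneg_left (Cav_le hg hfg hx) ha)
    (mul_le_mul_of_nonneg_left (Cav_le hg hfg hy) hb)

/-- The positively homogeneous extension of a function on the simplex to nonnegative vectors. -/
def perspective (g : (K → ℝ) → ℝ) (u : K → ℝ) : ℝ := (∑ k, u k) * g (fun k => u k / ∑ k', u k')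

lemma div_sum_mem_stdSimplex {u : K → ℝ} (hu : ∀ k, 0 ≤ u k) (h : ∑ k, u k ≠ 0) :
    (fun k => u k / ∑ k', u k') ∈ stdSimplex ℝ K :=
  ⟨fun k => div_nonneg (hu k) (Finset.sum_nonneg fun k _ => hu k), by
    rw [← Finset.sum_div, div_self h]⟩

lemma perspective_zero (g : (K → ℝ) → ℝ) : perspective g (fun _ => 0) = 0 := by
  simp [perspective]

/-- The normalisation of u + v is the convex combination of the normalisations of u and v weighted
by their masses; concavity there, times the total mass, is the claim. A vector of zero mass has no
normalisation in the simplex and is treated apart. -/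
lemma perspective_add_le {g : (K → ℝ) → ℝ} (hg : ConcaveOn ℝ (stdSimplex ℝ K) g) {u v : K → ℝ}
    (hu : ∀ k, 0 ≤ u k) (hv : ∀ k, 0 ≤ v k) :
    perspective g u + perspective g v ≤ perspective g (fun k => u k + v k) := by
  have hzero : ∀ {w : K → ℝ}, (∀ k, 0 ≤ w k) → ∑ k, w k = 0 → w = fun _ => 0 := fun hw h =>
    funext fun k => (Finset.sum_eq_zero_iff_of_nonneg fun k _ => hw k).1 h k (Finset.mem_univ k)
  rcases eq_or_ne (∑ k, u k) 0 with hU | hU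
  · rw [hzero hu hU, perspective_zero]; simp
  rcases eq_or_ne (∑ k, v k) 0 with hV | hV
  · rw [hzero hv hV, perspective_zero]; simp
  have hUpos : 0 < ∑ k, u k := lt_of_le_of_ne (Finset.sum_nonneg fun k _ => hu k) hU.symm
  have hVpos : 0 < ∑ k, v k := lt_of_le_of_ne (Finset.sum_nonneg fun k _ => hv k) hV.symm
  have h := hg.2 (div_sum_mem_stdSimplex hu hU) (div_sum_mem_stdSimplex hv hV)
    (show 0 ≤ (∑ k, u k) / (∑ k, u k + ∑ k, v k) by positivity)
    (show 0 ≤ (∑ k, v k) / (∑ k, u k + ∑ k, v k) by positivity) (by field_simp)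
  have hpt : ((∑ k, u k) / (∑ k, u k + ∑ k, v k)) • (fun k => u k / ∑ k', u k') +
      ((∑ k, v k) / (∑ k, u k + ∑ k, v k)) • (fun k => v k / ∑ k', v k') =
      fun k => (u k + v k) / ∑ k', (u k' + v k') := by
    funext k
    simp only [Pi.add_apply, Pi.smul_apply, smul_eq_mul, Finset.sum_add_distrib]
    field_simp
  rw [hpt] at h
  simp only [perspective]
  have h2 := mul_le_mul_of_nonneg_left h (add_pos hUpos hVpos).le
  rw [Finset.sum_add_distrib] at h2 ⊢
  refine le_trans (le_of_eq ?_) h2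
  simp only [smul_eq_mul]
  field_simp

omit [Fintype I] in
lemma sum_perspective_le {g : (K → ℝ) → ℝ} (hg : ConcaveOn ℝ (stdSimplex ℝ K) g) (t : Finset I)
    {w : I → K → ℝ} (hw : ∀ i k, 0 ≤ w i k) :
    ∑ i ∈ t, perspective g (w i) ≤ perspective g (fun k => ∑ i ∈ t, w i k) := by
  classical
  induction t using Finset.induction_on with
  | empty => simp [perspective_zero]
  | insert a t ha ih =>
    simp only [Finset.sum_insert ha]
    exact (add_le_add_right ih _).trans
      (perspective_add_le hg (hw a) fun k => Finset.sum_nonneg fun i _ => hw i k)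

end Concavification

/-! ### The law of the play as a sum over finite histories -/

section Bridge

variable {IA IB JA JB KA KB : Type*}

/-- The first `n` stages of an infinite play. -/
def playPrefix (n : ℕ) (ω : ℕ → Act IA IB JA JB) : Hist IA IB JA JB n := fun i => ω i

lemma measurable_playPrefix [MeasurableSpace IA] [MeasurableSpace IB]
    [MeasurableSpace JA] [MeasurableSpace JB] (n : ℕ) :
    Measurable (playPrefix n : (ℕ → Act IA IB JA JB) → Hist IA IB JA JB n) := by
  unfold playPrefix
  fun_prop

lemma playPrefix_succ (n : ℕ) (ω : ℕ → Act IA IB JA JB) :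
    playPrefix (n + 1) ω = Fin.snoc (playPrefix n ω) (ω n) := by
  funext i
  refine Fin.lastCases ?_ (fun i => ?_) i <;> simp [playPrefix]

variable [Fintype IA] [Fintype IB] [Fintype JA] [Fintype JB]

lemma toReal_stageLaw (s : Strategy IA IB JA JB (IA × IB)) (τA : Strategy IA IB JA JB JA)
    (τB : Strategy IA IB JA JB JB) (t : ℕ) (h : Hist IA IB JA JB t) (a : Act IA IB JA JB) :
    (stageLaw s τA τB t h a).toReal =
      (s t h a.1).toReal * ((τA t h a.2.1).toReal * (τB t h a.2.2).toReal) := by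
  classical
  obtain ⟨i, jA, jB⟩ := a
  rw [← ENNReal.toReal_mul, ← ENNReal.toReal_mul]
  congr 1
  simp only [stageLaw, PMF.bind_apply, PMF.map_apply, tsum_fintype]
  rw [Finset.sum_eq_single i, Finset.sum_eq_single jA, Finset.sum_eq_single jB]
  · simp
  · intro b _ hb
    simp [hb.symm]
  · simp
  · intro b _ hb
    simp [hb.symm]
  · simp
  · intro b _ hb
    simp [hb.symm]
  · simp

variable [MeasurableSpace IA] [DiscreteMeasurableSpace IA]
  [MeasurableSpace IB] [DiscreteMeasurableSpace IB]
  [MeasurableSpace JA] [DiscreteMeasurableSpace JA]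
  [MeasurableSpace JB] [DiscreteMeasurableSpace JB]

/-- Ties the Ionescu-Tulcea measure to finite products: from here on only prefix probabilities are
used, and expectations become finite sums. -/
lemma playLaw_playPrefix (s : Strategy IA IB JA JB (IA × IB)) (τA : Strategy IA IB JA JB JA)
    (τB : Strategy IA IB JA JB JB) (n : ℕ) (h : Hist IA IB JA JB n) :
    (playLaw s τA τB).real (playPrefix n ⁻¹' {h}) =
      pathWeight (fun n h a => (stageLaw s τA τB n h a).toReal) n h := by
  have hprob : IsProbabilityMeasure (stageLaw s τA τB 0 Fin.elim0).toMeasure :=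
    PMF.toMeasure.isProbabilityMeasure _
  induction n with
  | zero =>
    have : (playPrefix 0 ⁻¹' {h} : Set (ℕ → Act IA IB JA JB)) = Set.univ :=
      Set.eq_univ_of_forall fun ω => Subsingleton.elim _ _
    simp [this, pathWeight]
  | succ n ih =>
    obtain ⟨⟨h, a⟩, rfl⟩ : ∃ x : Hist IA IB JA JB n × Act IA IB JA JB,
        (Fin.snoc x.1 x.2 : Hist IA IB JA JB (n + 1)) = h :=
      ⟨(Fin.init h, h (Fin.last n)), Fin.snoc_init_self _⟩
    rw [pathWeight_snoc]
    have hset : (playPrefix (n + 1) ⁻¹' {(Fin.snoc h a : Hist IA IB JA JB (n + 1))} :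
        Set (ℕ → Act IA IB JA JB)) = {ω | playPrefix n ω = h ∧ ω n = a} := by
      ext ω
      simp only [Set.mem_preimage, Set.mem_singleton_iff, playPrefix_succ, Set.mem_ofPred_eq]
      exact Fin.snoc_injective2.eq_iff
    rw [hset]
    -- The first stage is drawn from the initial law of `Kernel.trajMeasure`; the kernels govern
    -- only the later ones.
    cases n with
    | zero =>
      have h0 : h = Fin.elim0 := Subsingleton.elim _ _
      have hset' : {ω : ℕ → Act IA IB JA JB | playPrefix 0 ω = h ∧ ω 0 = a} =
          (Preorder.frestrictLe 0 : (ℕ → Act IA IB JA JB) → _) ⁻¹'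
            {x | x ⟨0, by simp⟩ = a} := by
        ext ω
        simp [Preorder.frestrictLe, Subsingleton.elim (playPrefix 0 ω) h]
      have hm : MeasurableSet {x : Finset.Iic 0 → Act IA IB JA JB | x ⟨0, by simp⟩ = a} :=
        Set.Finite.measurableSet (Set.toFinite _)
      rw [hset', measureReal_def, ← Measure.map_apply (by fun_prop) hm, playLaw,
        Kernel.trajMeasure, Measure.map_comp _ _ (by fun_prop), Kernel.traj_map_frestrictLe,
        Kernel.partialTraj_self, Measure.id_comp, Measure.map_apply (by fun_prop) hm, h0]
      simp only [pathWeight, one_mul]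
      congr 1
      rw [← PMF.toMeasure_apply_singleton _ a (MeasurableSet.singleton a)]
      congr 1
    | succ n =>
      rw [← ih h]
      -- The same history of n + 1 stages, reindexed by the coordinates 0, …, n on which
      -- `stageKernel` is defined.
      set g : (i : Finset.Iic n) → Act IA IB JA JB :=
        fun i => h ⟨i, Nat.lt_succ_of_le (Finset.mem_Iic.1 i.2)⟩ with hg
      have hpre : ∀ ω : ℕ → Act IA IB JA JB,
          playPrefix (n + 1) ω = h ↔ Preorder.frestrictLe (π := fun _ => Act IA IB JA JB) n ω = g := by
        intro ω
        constructor
        · rintro rfl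
          funext i
          simp [hg, playPrefix, Preorder.frestrictLe]
        · intro hω
          funext i
          exact congrFun hω ⟨i, Finset.mem_Iic.2 (Nat.lt_succ_iff.1 i.2)⟩
      have hset' : {ω : ℕ → Act IA IB JA JB | playPrefix (n + 1) ω = h ∧ ω (n + 1) = a} =
          (fun ω => (Preorder.frestrictLe (π := fun _ => Act IA IB JA JB) n ω, ω (n + 1))) ⁻¹' ({g} ×ˢ {a}) := by
        ext ω
        simp [hpre]
      have hset'' : (playPrefix (n + 1) ⁻¹' {h} : Set (ℕ → Act IA IB JA JB)) =
          Preorder.frestrictLe (π := fun _ => Act IA IB JA JB) n ⁻¹' {g} := by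
        ext ω
        simp [hpre]
      rw [hset', hset'', measureReal_def, measureReal_def,
        ← Measure.map_apply (by fun_prop)
          ((MeasurableSet.singleton g).prod (MeasurableSet.singleton a)), playLaw,
        ← Kernel.map_frestrictLe_trajMeasure_compProd_eq_map_trajMeasure,
        Measure.compProd_apply_prod (MeasurableSet.singleton g) (MeasurableSet.singleton a),
        lintegral_singleton, Measure.map_apply (by fun_prop) (MeasurableSet.singleton g),
        ENNReal.toReal_mul, mul_comm]
      congr 2
      exact PMF.toMeasure_apply_singleton _ a (MeasurableSet.singleton a)

end Bridge

/-! ### Expected payoffs as finite sums -/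

section RealStrategies

variable {IA IB JA JB KA KB : Type*}

lemma sum_toReal_pmf {X : Type*} [Fintype X] (q : PMF X) : ∑ x, (q x).toReal = 1 := by
  have h := q.tsum_coe
  rw [tsum_fintype] at h
  rw [← ENNReal.toReal_sum fun x _ => q.apply_ne_top x, h, ENNReal.toReal_one]

/-- The lotteries of the informed player as real vectors. -/
def informedLottery (σ : InformedStrategy IA IB JA JB KA KB) (k : KA × KB) (n : ℕ)
    (h : Fin n → (IA × IB) × (JA × JB)) (i : IA × IB) : ℝ :=
  (σ k n h i).toReal

/-- The independent lotteries of the two uninformed players as a real vector. -/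
def opponentsLottery (τA : Strategy IA IB JA JB JA) (τB : Strategy IA IB JA JB JB) (n : ℕ)
    (h : Fin n → (IA × IB) × (JA × JB)) (j : JA × JB) : ℝ :=
  (τA n h j.1).toReal * (τB n h j.2).toReal

lemma informedLottery_nonneg (σ : InformedStrategy IA IB JA JB KA KB) (k : KA × KB) (n : ℕ)
    (h : Fin n → (IA × IB) × (JA × JB)) (i : IA × IB) : 0 ≤ informedLottery σ k n h i :=
  ENNReal.toReal_nonneg

lemma opponentsLottery_nonneg (τA : Strategy IA IB JA JB JA) (τB : Strategy IA IB JA JB JB)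
    (n : ℕ) (h : Fin n → (IA × IB) × (JA × JB)) (j : JA × JB) :
    0 ≤ opponentsLottery τA τB n h j :=
  mul_nonneg ENNReal.toReal_nonneg ENNReal.toReal_nonneg

lemma sum_informedLottery [Fintype IA] [Fintype IB] (σ : InformedStrategy IA IB JA JB KA KB)
    (k : KA × KB) (n : ℕ) (h : Fin n → (IA × IB) × (JA × JB)) :
    ∑ i, informedLottery σ k n h i = 1 :=
  sum_toReal_pmf _

lemma sum_opponentsLottery [Fintype JA] [Fintype JB] (τA : Strategy IA IB JA JB JA)
    (τB : Strategy IA IB JA JB JB) (n : ℕ) (h : Fin n → (IA × IB) × (JA × JB)) :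
    ∑ j, opponentsLottery τA τB n h j = 1 := by
  simp only [opponentsLottery, Fintype.sum_prod_type, ← Finset.mul_sum, sum_toReal_pmf, mul_one]

lemma priorVec_nonneg (G : Game IA IB JA JB KA KB) (k : KA × KB) : 0 ≤ priorVec G k :=
  ENNReal.toReal_nonneg

lemma sum_priorVec [Fintype KA] [Fintype KB] (G : Game IA IB JA JB KA KB) :
    ∑ k, priorVec G k = 1 :=
  sum_toReal_pmf _

end RealStrategies

set_option linter.unusedSectionVars false

/-! ### Expectations under the joint law of play and state -/

section Expectations

variable {IA IB JA JB KA KB : Type*}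
  [Fintype IA] [MeasurableSpace IA] [DiscreteMeasurableSpace IA]
  [Fintype IB] [MeasurableSpace IB] [DiscreteMeasurableSpace IB]
  [Fintype JA] [MeasurableSpace JA] [DiscreteMeasurableSpace JA]
  [Fintype JB] [MeasurableSpace JB] [DiscreteMeasurableSpace JB]
  [Fintype KA] [MeasurableSpace KA] [DiscreteMeasurableSpace KA]
  [Fintype KB] [MeasurableSpace KB] [DiscreteMeasurableSpace KB]

lemma integral_playLaw_playPrefix (s : Strategy IA IB JA JB (IA × IB))
    (τA : Strategy IA IB JA JB JA) (τB : Strategy IA IB JA JB JB) (n : ℕ)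
    (f : Hist IA IB JA JB n → ℝ) :
    ∫ ω, f (playPrefix n ω) ∂(playLaw s τA τB) =
      ∑ h, pathWeight (fun n h a => (stageLaw s τA τB n h a).toReal) n h * f h := by
  rw [← integral_map (φ := playPrefix n) (measurable_playPrefix n).aemeasurable
    (by fun_prop : AEStronglyMeasurable f _)]
  have := Measure.isProbabilityMeasure_map (μ := playLaw s τA τB)
    (measurable_playPrefix n).aemeasurable
  rw [integral_fintype .of_finite]
  refine Finset.sum_congr rfl fun h _ => ?_
  rw [map_measureReal_apply (measurable_playPrefix n) (MeasurableSet.singleton h),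
    playLaw_playPrefix, smul_eq_mul]

variable (G : Game IA IB JA JB KA KB) (σ : InformedStrategy IA IB JA JB KA KB)
  (τA : Strategy IA IB JA JB JA) (τB : Strategy IA IB JA JB JB)

lemma integral_outcomeLaw {F : Outcome IA IB JA JB KA KB → ℝ} (hF : Measurable F)
    {C : ℝ} (hC : ∀ ω, |F ω| ≤ C) :
    ∫ ω, F ω ∂(outcomeLaw G σ τA τB) =
      ∑ k, priorVec G k * ∫ ω, F (ω, k) ∂(playLaw (σ k) τA τB) := by
  have hint : ∀ (μ : Measure (Outcome IA IB JA JB KA KB)) [IsFiniteMeasure μ], Integrable F μ :=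
    fun μ _ => .of_bound hF.aestronglyMeasurable C (.of_forall hC)
  rw [outcomeLaw, integral_finsetSum_measure
    fun k _ => (hint _).smul_measure (G.prior.apply_ne_top k)]
  refine Finset.sum_congr rfl fun k _ => ?_
  rw [integral_smul_measure, Measure.prod_dirac,
    integral_map (by fun_prop) hF.aestronglyMeasurable, smul_eq_mul, priorVec]

lemma measurable_prefix_state (n : ℕ) : Measurable
    (fun ω : Outcome IA IB JA JB KA KB => (playPrefix n ω.1, ω.2)) :=
  ((measurable_playPrefix n).comp measurable_fst).prodMk measurable_snd

lemma measurable_comp_prefix_state (n : ℕ) (f : Hist IA IB JA JB n × (KA × KB) → ℝ) :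
    Measurable (fun ω : Outcome IA IB JA JB KA KB => f (playPrefix n ω.1, ω.2)) :=
  (Measurable.of_discrete (f := f)).comp (measurable_prefix_state n)

lemma integrable_comp_prefix_state (n : ℕ) (f : Hist IA IB JA JB n × (KA × KB) → ℝ) :
    Integrable (fun ω : Outcome IA IB JA JB KA KB => f (playPrefix n ω.1, ω.2))
      (outcomeLaw G σ τA τB) := by
  have := Measure.isProbabilityMeasure_map (μ := outcomeLaw G σ τA τB)
    (measurable_prefix_state n).aemeasurable
  exact (Integrable.of_finite (f := f)).comp_measurable (measurable_prefix_state n)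

/-- Since the players randomise independently given the past, the probability of a history in state
k factors into an opponents' part free of k and the likelihood of the informed player's actions,
which the prior completes to the state weight. -/
lemma integral_outcomeLaw_prefix (n : ℕ) (f : Hist IA IB JA JB n × (KA × KB) → ℝ) :
    ∫ ω, f (playPrefix n ω.1, ω.2) ∂(outcomeLaw G σ τA τB) =
      ∑ h : Hist IA IB JA JB n, oppWeight (opponentsLottery τA τB) n h *
        ∑ k, stateWeight (priorVec G) (informedLottery σ) n h k * f (h, k) := by
  obtain ⟨C, hC⟩ := (Set.finite_range fun x => |f x|).bddAbove
  rw [integral_outcomeLaw G σ τA τB (measurable_comp_prefix_state n f)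
    (fun ω => hC ⟨_, rfl⟩)]
  have hk : ∀ k, ∫ ω, f (playPrefix n ω, k) ∂(playLaw (σ k) τA τB) = _ := fun k =>
    integral_playLaw_playPrefix (σ k) τA τB n fun h => f (h, k)
  simp only [hk, Finset.mul_sum]
  rw [Finset.sum_comm]
  refine Finset.sum_congr rfl fun h _ => Finset.sum_congr rfl fun k _ => ?_
  have : pathWeight (fun n h a => (stageLaw (σ k) τA τB n h a).toReal) n h =
      pathWeight (fun n h (a : Act IA IB JA JB) => informedLottery σ k n h a.1) n h *
        oppWeight (opponentsLottery τA τB) n h := by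
    simp only [toReal_stageLaw, oppWeight]
    exact pathWeight_mul _ _ n h
  rw [this, stateWeight]
  ring

/-- The expected value of a function of the state and the actions of one stage. -/
lemma integral_stage (N : KA × KB → IA × IB → JA × JB → ℝ) (t : ℕ) :
    ∫ ω, N ω.2 (ω.1 t).1 (ω.1 t).2 ∂(outcomeLaw G σ τA τB) =
      stageCost (priorVec G) (informedLottery σ) (opponentsLottery τA τB) N t := by
  have h := integral_outcomeLaw_prefix G σ τA τB (t + 1)
    (fun x => N x.2 (x.1 (Fin.last t)).1 (x.1 (Fin.last t)).2)
  have hlast : ∀ ω : ℕ → Act IA IB JA JB, playPrefix (t + 1) ω (Fin.last t) = ω t := fun _ => rfl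
  simp only [hlast] at h
  rw [h, sum_fin_succ_eq_sum_snoc, stageCost]
  refine Finset.sum_congr rfl fun h _ => ?_
  simp only [oppWeight_snoc, stateWeight_snoc, Fin.snoc_last, Finset.mul_sum]
  rw [Finset.sum_comm]
  refine Finset.sum_congr rfl fun k _ => ?_
  rw [Fintype.sum_prod_type]
  refine Finset.sum_congr rfl fun i _ => Finset.sum_congr rfl fun j _ => ?_
  ring

lemma measurable_stage (N : KA × KB → IA × IB → JA × JB → ℝ) (t : ℕ) :
    Measurable fun ω : Outcome IA IB JA JB KA KB => N ω.2 (ω.1 t).1 (ω.1 t).2 :=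
  measurable_comp_prefix_state (t + 1)
    (fun x => N x.2 (x.1 (Fin.last t)).1 (x.1 (Fin.last t)).2)

lemma integrable_stage (N : KA × KB → IA × IB → JA × JB → ℝ) (t : ℕ) :
    Integrable (fun ω => N ω.2 (ω.1 t).1 (ω.1 t).2) (outcomeLaw G σ τA τB) :=
  integrable_comp_prefix_state G σ τA τB (t + 1)
    (fun x => N x.2 (x.1 (Fin.last t)).1 (x.1 (Fin.last t)).2)

lemma integral_average (N : KA × KB → IA × IB → JA × JB → ℝ) (T : ℕ) :
    ∫ ω, (1 / (T : ℝ)) * ∑ t ∈ Finset.range T, N ω.2 (ω.1 t).1 (ω.1 t).2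
        ∂(outcomeLaw G σ τA τB) =
      1 / (T : ℝ) * ∑ t ∈ Finset.range T,
        stageCost (priorVec G) (informedLottery σ) (opponentsLottery τA τB) N t := by
  rw [integral_const_mul, integral_finsetSum _ fun t _ => integrable_stage G σ τA τB N t]
  simp only [integral_stage]

lemma betaAvgA_eq (T : ℕ) : betaAvgA G T σ τA τB = -(1 / (T : ℝ) * ∑ t ∈ Finset.range T,
    stageCost (priorVec G) (informedLottery σ) (opponentsLottery τA τB)
      (fun k i j => G.A k.1 i.1 j.1) t) := by
  rw [← integral_average G σ τA τB fun k i j => G.A k.1 i.1 j.1, ← integral_neg, betaAvgA]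
  simp only [Finset.sum_neg_distrib, mul_neg]

lemma betaAvgB_eq (T : ℕ) : betaAvgB G T σ τA τB = -(1 / (T : ℝ) * ∑ t ∈ Finset.range T,
    stageCost (priorVec G) (informedLottery σ) (opponentsLottery τA τB)
      (fun k i j => G.B k.2 i.2 j.2) t) := by
  rw [← integral_average G σ τA τB fun k i j => G.B k.2 i.2 j.2, ← integral_neg, betaAvgB]
  simp only [Finset.sum_neg_distrib, mul_neg]

lemma stageCost_add {I J K : Type*} [Fintype I] [Fintype J] [Fintype K] (p : K → ℝ)
    (s : K → (n : ℕ) → (Fin n → I × J) → I → ℝ) (y : (n : ℕ) → (Fin n → I × J) → J → ℝ)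
    (N N' : K → I → J → ℝ) (n : ℕ) :
    stageCost p s y (fun k i j => N k i j + N' k i j) n =
      stageCost p s y N n + stageCost p s y N' n := by
  simp only [stageCost, mul_add, Finset.sum_add_distrib]

/-- The stage payoffs of the three players add up to zero. -/
lemma sum_priorVec_mul_alphaAvg (T : ℕ) :
    ∑ k, priorVec G k * alphaAvg G T k σ τA τB =
      -(betaAvgA G T σ τA τB + betaAvgB G T σ τA τB) := by
  set N : KA × KB → IA × IB → JA × JB → ℝ := fun k i j => G.A k.1 i.1 j.1 + G.B k.2 i.2 j.2
    with hN
  obtain ⟨C, hC⟩ := exists_forall_abs_le N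
  have hmeas : Measurable fun ω : Outcome IA IB JA JB KA KB =>
      (1 / (T : ℝ)) * ∑ t ∈ Finset.range T, N ω.2 (ω.1 t).1 (ω.1 t).2 :=
    (Finset.measurable_fun_sum _ fun t _ => measurable_stage N t).const_mul _
  have hbound : ∀ ω : Outcome IA IB JA JB KA KB,
      |(1 / (T : ℝ)) * ∑ t ∈ Finset.range T, N ω.2 (ω.1 t).1 (ω.1 t).2| ≤
        1 / (T : ℝ) * ∑ _t ∈ Finset.range T, C := fun ω => by
    rw [abs_mul, abs_of_nonneg (by positivity : 0 ≤ 1 / (T : ℝ))]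
    gcongr
    exact (Finset.abs_sum_le_sum_abs _ _).trans (Finset.sum_le_sum fun t _ => hC _ _ _)
  have h := integral_outcomeLaw G σ τA τB hmeas hbound
  rw [integral_average] at h
  rw [betaAvgA_eq, betaAvgB_eq]
  refine h.symm.trans ?_
  simp only [hN, stageCost_add, Finset.sum_add_distrib]
  ring

end Expectations

/-! ### Image weights -/

section Push

variable {I J K I' J' K' : Type*} [Fintype I] [Fintype J] [Fintype K]

open Classical in
/-- The image of the weights `u` under `π`. -/
def pushWeight (π : K → K') (u : K → ℝ) (a : K') : ℝ := ∑ k, if π k = a then u k else 0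

lemma pushWeight_nonneg (π : K → K') {u : K → ℝ} (hu : ∀ k, 0 ≤ u k) (a : K') :
    0 ≤ pushWeight π u a :=
  Finset.sum_nonneg fun k _ => by split_ifs <;> simp [hu]

lemma sum_pushWeight_mul [Fintype K'] (π : K → K') (u : K → ℝ) (f : K' → ℝ) :
    ∑ a, pushWeight π u a * f a = ∑ k, u k * f (π k) := by
  simp only [pushWeight, Finset.sum_mul]
  rw [Finset.sum_comm]
  refine Finset.sum_congr rfl fun k _ => ?_
  rw [Finset.sum_eq_single (π k)] <;> simp +contextual [eq_comm]

lemma sum_pushWeight [Fintype K'] (π : K → K') (u : K → ℝ) : ∑ a, pushWeight π u a = ∑ k, u k := by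
  simpa using sum_pushWeight_mul π u fun _ => 1

lemma pushWeight_sum (π : K → K') (u : I → K → ℝ) (a : K') :
    pushWeight π (fun k => ∑ i, u i k) a = ∑ i, pushWeight π (u i) a := by
  simp only [pushWeight]
  rw [Finset.sum_comm]
  refine Finset.sum_congr rfl fun k _ => ?_
  split_ifs <;> simp

lemma pushWeight_div (π : K → K') (u : K → ℝ) (c : ℝ) (a : K') :
    pushWeight π (fun k => u k / c) a = pushWeight π u a / c := by
  simp only [pushWeight, Finset.sum_div]
  refine Finset.sum_congr rfl fun k _ => ?_
  split_ifs <;> simp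

/-- Writing marginals as images under a projection lets the same lemmas serve both uninformed
players. -/
lemma margA_eq_pushWeight {KA KB : Type*} [Fintype KA] [Fintype KB] (u : KA × KB → ℝ) :
    margA u = pushWeight Prod.fst u := by
  funext a
  simp only [margA, pushWeight, Fintype.sum_prod_type]
  rw [Finset.sum_eq_single a] <;> simp +contextual

lemma margB_eq_pushWeight {KA KB : Type*} [Fintype KA] [Fintype KB] (u : KA × KB → ℝ) :
    margB u = pushWeight Prod.snd u := by
  funext b
  simp only [margB, pushWeight, Fintype.sum_prod_type]
  refine Finset.sum_congr rfl fun a _ => ?_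
  rw [Finset.sum_eq_single b] <;> simp +contextual

/-- Splitting a state weight by an action does not raise a concave function of the posterior of
`π`. -/
lemma sum_perspective_pushWeight_le [Fintype K'] {g : (K' → ℝ) → ℝ}
    (hg : ConcaveOn ℝ (stdSimplex ℝ K') g) (π : K → K') (u : K → ℝ) (t : K → I → ℝ)
    (hu : ∀ k, 0 ≤ u k) (ht : ∀ k i, 0 ≤ t k i) (ht1 : ∀ k, ∑ i, t k i = 1) :
    ∑ i, perspective g (pushWeight π fun k => u k * t k i) ≤ perspective g (pushWeight π u) := by
  refine (sum_perspective_le hg Finset.univ fun i =>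
    pushWeight_nonneg π fun k => mul_nonneg (hu k) (ht k i)).trans (le_of_eq ?_)
  congr 1
  funext a
  rw [← pushWeight_sum]
  simp only [← Finset.mul_sum, ht1, mul_one]

/-- Against a nearly optimal lottery for the posterior, the average lottery of the informed player
yields at most the concavified value. -/
lemma sum_avgAction_le_perspective [Fintype I'] [Fintype J'] [Fintype K'] [Nonempty I']
    [Nonempty J'] (M : K' → I' → J' → ℝ) (πK : K → K') (πI : I → I') (πJ : J → J') {u : K → ℝ}
    (hu : ∀ k, 0 ≤ u k) {s : K → I → ℝ} (hs : ∀ k i, 0 ≤ s k i) (hs1 : ∀ k, ∑ i, s k i = 1)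
    (y : J → ℝ) {δ : ℝ}
    (hy : ∑ k, u k ≠ 0 → ∀ x : stdSimplex ℝ I',
      ∑ i, ∑ j, x.1 i * (∑ a, pushWeight πK u a / (∑ k, u k) * M a i j) * pushWeight πJ y j ≤
        nonRevealingValue M (fun a => pushWeight πK u a / ∑ k, u k) + δ) :
    ∑ k, u k * ∑ i, avgAction u s i * ∑ j, y j * M (πK k) (πI i) (πJ j) ≤
      perspective (Cav (nonRevealingValue M)) (pushWeight πK u) + δ * ∑ k, u k := by
  rcases eq_or_ne (∑ k, u k) 0 with hU | hU
  · have h0 : ∀ k, u k = 0 := fun k =>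
      (Finset.sum_eq_zero_iff_of_nonneg fun k _ => hu k).1 hU k (Finset.mem_univ k)
    simp [perspective, sum_pushWeight, h0]
  set U := ∑ k, u k with hUdef
  have hUpos : 0 < U := lt_of_le_of_ne (Finset.sum_nonneg fun k _ => hu k) hU.symm
  set q : K' → ℝ := fun a => pushWeight πK u a / U with hq
  have hqmem : q ∈ stdSimplex ℝ K' := by
    have := div_sum_mem_stdSimplex (pushWeight_nonneg πK hu) (by rwa [sum_pushWeight])
    rwa [sum_pushWeight] at this
  -- The averaged lottery does not depend on the state, so its image is a legitimate strategy of the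
  -- maximiser in the non-revealing game at q.
  let x : stdSimplex ℝ I' := ⟨pushWeight πI (avgAction u s),
    pushWeight_nonneg πI (avgAction_nonneg hu hs), by rw [sum_pushWeight, sum_avgAction hU hs1]⟩
  obtain ⟨C, hC⟩ := exists_nonRevealingValue_le M
  have hval : ∑ k, u k * ∑ i, avgAction u s i * ∑ j, y j * M (πK k) (πI i) (πJ j) =
      U * ∑ i, ∑ j, x.1 i * (∑ a, q a * M a i j) * pushWeight πJ y j := by
    have hJ : ∀ a i, ∑ j, y j * M a i (πJ j) = ∑ j, pushWeight πJ y j * M a i j := fun a i =>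
      (sum_pushWeight_mul πJ y (M a i)).symm
    have hI : ∀ a, ∑ i, avgAction u s i * ∑ j, pushWeight πJ y j * M a (πI i) j =
        ∑ i, pushWeight πI (avgAction u s) i * ∑ j, pushWeight πJ y j * M a i j := fun a =>
      (sum_pushWeight_mul πI (avgAction u s) fun i => ∑ j, pushWeight πJ y j * M a i j).symm
    simp only [hJ, hI]
    rw [← sum_pushWeight_mul πK u
      fun a => ∑ i, pushWeight πI (avgAction u s) i * ∑ j, pushWeight πJ y j * M a i j]
    simp only [x, hq, Finset.mul_sum, Finset.sum_mul]
    rw [Finset.sum_comm]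
    refine Finset.sum_congr rfl fun i _ => ?_
    rw [Finset.sum_comm]
    refine Finset.sum_congr rfl fun j _ => Finset.sum_congr rfl fun a _ => ?_
    field_simp
  have hper : perspective (Cav (nonRevealingValue M)) (pushWeight πK u) =
      U * Cav (nonRevealingValue M) q := by
    simp only [perspective, sum_pushWeight, ← hUdef, hq]
  rw [hval, hper]
  calc U * ∑ i, ∑ j, x.1 i * (∑ a, q a * M a i j) * pushWeight πJ y j
      ≤ U * (Cav (nonRevealingValue M) q + δ) :=
        mul_le_mul_of_nonneg_left ((hy hU x).trans (by linarith [le_Cav hC hqmem])) hUpos.le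
    _ = _ := by ring

end Push

/-! ### Deviations of the uninformed players -/

section Deviations

variable {IA IB JA JB KA KB : Type*}

lemma exists_pmf_toReal_eq {X : Type*} [Fintype X] (y : stdSimplex ℝ X) :
    ∃ q : PMF X, ∀ x, (q x).toReal = y.1 x := by
  refine ⟨PMF.ofFintype (fun x => ENNReal.ofReal (y.1 x)) ?_, fun x => ?_⟩
  · rw [← ENNReal.ofReal_sum_of_nonneg fun x _ => y.2.1 x, y.2.2, ENNReal.ofReal_one]
  · rw [PMF.ofFintype_apply, ENNReal.toReal_ofReal (y.2.1 x)]

/-- The strategy that follows `τ` before stage `t₀` and `z` afterwards. -/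
def switchAt {X : Type*} (t₀ : ℕ) (τ z : Strategy IA IB JA JB X) : Strategy IA IB JA JB X :=
  fun n h => if n < t₀ then τ n h else z n h

lemma pushWeight_fst_opponentsLottery [Fintype JA] [Fintype JB] (τA : Strategy IA IB JA JB JA)
    (τB : Strategy IA IB JA JB JB) (n : ℕ) (h : Fin n → (IA × IB) × (JA × JB)) (j : JA) :
    pushWeight Prod.fst (opponentsLottery τA τB n h) j = (τA n h j).toReal := by
  rw [← margA_eq_pushWeight]
  simp [margA, opponentsLottery, ← Finset.mul_sum, sum_toReal_pmf]

lemma pushWeight_snd_opponentsLottery [Fintype JA] [Fintype JB] (τA : Strategy IA IB JA JB JA)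
    (τB : Strategy IA IB JA JB JB) (n : ℕ) (h : Fin n → (IA × IB) × (JA × JB)) (j : JB) :
    pushWeight Prod.snd (opponentsLottery τA τB n h) j = (τB n h j).toReal := by
  rw [← margB_eq_pushWeight]
  simp [margB, opponentsLottery, ← Finset.sum_mul, sum_toReal_pmf]

/-- A strategy that plays nearly optimally in the non-revealing game
with payoffs `M` at the posterior of `π`. -/
lemma exists_strategy_bilinear_le [Fintype IA] [Fintype IB] [Fintype JA] [Fintype JB]
    [Fintype KA] [Fintype KB] {I' J' K' : Type*} [Fintype I'] [Fintype J'] [Fintype K']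
    [Nonempty J'] (M : K' → I' → J' → ℝ) (π : KA × KB → K') {δ : ℝ} (hδ : 0 < δ)
    (u : (n : ℕ) → Hist IA IB JA JB n → KA × KB → ℝ) (hu : ∀ n h k, 0 ≤ u n h k) :
    ∃ z : Strategy IA IB JA JB J', ∀ n h, ∑ k, u n h k ≠ 0 → ∀ x : stdSimplex ℝ I',
      ∑ i, ∑ j, x.1 i * (∑ a, pushWeight π (u n h) a / (∑ k, u n h k) * M a i j) *
          (z n h j).toReal ≤
        nonRevealingValue M (fun a => pushWeight π (u n h) a / ∑ k, u n h k) + δ := by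
  have hex : ∀ (n : ℕ) (h : Hist IA IB JA JB n), ∃ z : PMF J', ∑ k, u n h k ≠ 0 →
      ∀ x : stdSimplex ℝ I',
      ∑ i, ∑ j, x.1 i * (∑ a, pushWeight π (u n h) a / (∑ k, u n h k) * M a i j) *
          (z j).toReal ≤
        nonRevealingValue M (fun a => pushWeight π (u n h) a / ∑ k, u n h k) + δ := by
    intro n h
    by_cases hU : ∑ k, u n h k = 0
    -- With zero total weight there is no posterior to respond to, and any lottery will do.
    · exact ⟨PMF.pure (Classical.arbitrary J'), fun h => absurd hU h⟩
    · have hq := div_sum_mem_stdSimplex (pushWeight_nonneg π (hu n h)) (by rwa [sum_pushWeight])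
      rw [sum_pushWeight] at hq
      obtain ⟨y, hy⟩ := exists_forall_bilinear_le_nonRevealingValue_add (I := I') M hq hδ
      obtain ⟨z, hz⟩ := exists_pmf_toReal_eq y
      exact ⟨z, fun _ x => by simpa only [hz] using hy x⟩
  choose z hz using hex
  exact ⟨z, hz⟩

variable [Fintype IA] [Fintype IB] [Fintype JA] [Fintype JB] [Fintype KA] [Fintype KB]

/-- The expected concavified value of the posterior of `π` after `n` stages. -/
def expectedCav {I' J' K' : Type*} [Fintype I'] [Fintype J'] [Fintype K']
    (G : Game IA IB JA JB KA KB) (σ : InformedStrategy IA IB JA JB KA KB)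
    (τA : Strategy IA IB JA JB JA) (τB : Strategy IA IB JA JB JB) (M : K' → I' → J' → ℝ)
    (π : KA × KB → K') (n : ℕ) : ℝ :=
  levelSum (priorVec G) (informedLottery σ) (opponentsLottery τA τB)
    (fun u => perspective (Cav (nonRevealingValue M)) (pushWeight π u)) n

variable (G : Game IA IB JA JB KA KB) (σ : InformedStrategy IA IB JA JB KA KB)
  (τA : Strategy IA IB JA JB JA) (τB : Strategy IA IB JA JB JB)

/-- State weights do not involve the opponents, and the law of histories of length t₀ involves only
their lotteries before t₀. Hence a deviation that starts at t₀ does not change this expectation. -/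
lemma expectedCav_congr {I' J' K' : Type*} [Fintype I'] [Fintype J'] [Fintype K']
    {τA' : Strategy IA IB JA JB JA} {τB' : Strategy IA IB JA JB JB} (M : K' → I' → J' → ℝ)
    (π : KA × KB → K') {t₀ : ℕ} (hA : ∀ n < t₀, τA' n = τA n) (hB : ∀ n < t₀, τB' n = τB n) :
    expectedCav G σ τA' τB' M π t₀ = expectedCav G σ τA τB M π t₀ := by
  simp only [expectedCav, levelSum, oppWeight]
  rw [pathWeight_congr t₀ fun m hm => ?_]
  simp only [opponentsLottery, hA m hm, hB m hm]

/-- If from stage `t₀` on the marginal on `J'` of the play of the uninformed players is nearly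
optimal at the posterior of `π`, the long-run average cost is at most the expected concavified
value at `t₀`. -/
lemma eventually_average_le_expectedCav {I' J' K' : Type*} [Fintype I'] [Fintype J']
    [Fintype K'] [Nonempty I'] [Nonempty J'] (M : K' → I' → J' → ℝ) (πK : KA × KB → K')
    (πI : IA × IB → I') (πJ : JA × JB → J') {δ : ℝ} (hδ : 0 < δ) (t₀ : ℕ)
    (hopt : ∀ n ≥ t₀, ∀ h : Hist IA IB JA JB n,
      ∑ k, stateWeight (priorVec G) (informedLottery σ) n h k ≠ 0 → ∀ x : stdSimplex ℝ I',
      ∑ i, ∑ j, x.1 i * (∑ a, pushWeight πK (stateWeight (priorVec G) (informedLottery σ) n h) a /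
          (∑ k, stateWeight (priorVec G) (informedLottery σ) n h k) * M a i j) *
          pushWeight πJ (opponentsLottery τA τB n h) j ≤
        nonRevealingValue M (fun a =>
          pushWeight πK (stateWeight (priorVec G) (informedLottery σ) n h) a /
            ∑ k, stateWeight (priorVec G) (informedLottery σ) n h k) + δ) :
    ∀ᶠ T : ℕ in atTop, 1 / (T : ℝ) * ∑ t ∈ Finset.range T,
      stageCost (priorVec G) (informedLottery σ) (opponentsLottery τA τB)
        (fun k i j => M (πK k) (πI i) (πJ j)) t ≤ expectedCav G σ τA τB M πK t₀ + 3 * δ := by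
  obtain ⟨C, hC⟩ := exists_nonRevealingValue_le M
  exact eventually_average_stageCost_le (priorVec_nonneg G) (sum_priorVec G)
    (informedLottery_nonneg σ) (sum_informedLottery σ) (opponentsLottery_nonneg τA τB)
    (sum_opponentsLottery τA τB) (sum_perspective_pushWeight_le (concaveOn_Cav hC) πK) _ hδ t₀
    fun n hn h => sum_avgAction_le_perspective M πK πI πJ
      (stateWeight_nonneg (priorVec_nonneg G) (informedLottery_nonneg σ) n h)
      (fun k i => informedLottery_nonneg σ k n h i) (fun k => sum_informedLottery σ k n h) _
      (hopt n hn h)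

/-- Jensen's inequality for one stage of revelation, at every history. -/
lemma expectedCav_succ_le {I' J' K' : Type*} [Fintype I'] [Fintype J']
    [Fintype K'] [Nonempty I'] [Nonempty J'] (M : K' → I' → J' → ℝ) (π : KA × KB → K') (n : ℕ) :
    expectedCav G σ τA τB M π (n + 1) ≤ expectedCav G σ τA τB M π n := by
  obtain ⟨C, hC⟩ := exists_nonRevealingValue_le M
  exact levelSum_succ_le (priorVec_nonneg G)
    (informedLottery_nonneg σ) (sum_informedLottery σ) (opponentsLottery_nonneg τA τB)
    (sum_opponentsLottery τA τB) (sum_perspective_pushWeight_le (concaveOn_Cav hC) π) n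

lemma expectedCav_zero {I' J' K' : Type*} [Fintype I'] [Fintype J'] [Fintype K']
    (M : K' → I' → J' → ℝ) (π : KA × KB → K') :
    expectedCav G σ τA τB M π 0 = Cav (nonRevealingValue M) (pushWeight π (priorVec G)) := by
  have hsw : ∀ h : Fin 0 → (IA × IB) × (JA × JB),
      stateWeight (priorVec G) (informedLottery σ) 0 h = priorVec G := fun h => by
    funext k
    simp [stateWeight, pathWeight]
  simp [expectedCav, levelSum, hsw, oppWeight, pathWeight, perspective, sum_pushWeight,
    sum_priorVec]

end Deviations

/-! ### Consequences of the equilibrium conditions -/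

section Equilibrium

variable {IA IB JA JB KA KB : Type*}
  [Fintype IA] [MeasurableSpace IA] [DiscreteMeasurableSpace IA]
  [Fintype IB] [MeasurableSpace IB] [DiscreteMeasurableSpace IB]
  [Fintype JA] [MeasurableSpace JA] [DiscreteMeasurableSpace JA]
  [Fintype JB] [MeasurableSpace JB] [DiscreteMeasurableSpace JB]
  [Fintype KA] [MeasurableSpace KA] [DiscreteMeasurableSpace KA]
  [Fintype KB] [MeasurableSpace KB] [DiscreteMeasurableSpace KB]
  (G : Game IA IB JA JB KA KB) (σ : InformedStrategy IA IB JA JB KA KB)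
  (τA : Strategy IA IB JA JB JA) (τB : Strategy IA IB JA JB JB)

/-- From any stage on player 2 can keep the payoff below the expected concavified value. -/
lemma exists_deviationA [Nonempty IA] [Nonempty JA] {δ : ℝ} (hδ : 0 < δ) (t₀ : ℕ) :
    ∃ τA' : Strategy IA IB JA JB JA, ∀ᶠ T : ℕ in atTop,
      -betaAvgA G T σ τA' τB ≤ expectedCav G σ τA τB G.A Prod.fst t₀ + 3 * δ := by
  obtain ⟨z, hz⟩ := exists_strategy_bilinear_le (IA := IA) (IB := IB) (JA := JA) (JB := JB) G.A
    (Prod.fst : KA × KB → KA) hδ (stateWeight (priorVec G) (informedLottery σ))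
    (stateWeight_nonneg (priorVec_nonneg G) (informedLottery_nonneg σ))
  -- Following τA before t₀ preserves the expected concavified value at t₀; from then on z answers
  -- the posterior on the states of A.
  refine ⟨switchAt t₀ τA z, ?_⟩
  have h := eventually_average_le_expectedCav G σ (switchAt t₀ τA z) τB G.A Prod.fst Prod.fst
    Prod.fst hδ t₀ fun n hn h hU x => by
      simpa only [pushWeight_fst_opponentsLottery, switchAt, if_neg (not_lt.2 hn)] using hz n h hU x
  rw [expectedCav_congr (τA' := switchAt t₀ τA z) G σ τA τB G.A Prod.fst (fun n hn => funext fun h => if_pos hn)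
    fun n _ => rfl] at h
  simpa only [betaAvgA_eq, neg_neg] using h

/-- From any stage on player 3 can keep the payoff below the expected concavified value. -/
lemma exists_deviationB [Nonempty IB] [Nonempty JB] {δ : ℝ} (hδ : 0 < δ) (t₀ : ℕ) :
    ∃ τB' : Strategy IA IB JA JB JB, ∀ᶠ T : ℕ in atTop,
      -betaAvgB G T σ τA τB' ≤ expectedCav G σ τA τB G.B Prod.snd t₀ + 3 * δ := by
  obtain ⟨z, hz⟩ := exists_strategy_bilinear_le (IA := IA) (IB := IB) (JA := JA) (JB := JB) G.B
    (Prod.snd : KA × KB → KB) hδ (stateWeight (priorVec G) (informedLottery σ))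
    (stateWeight_nonneg (priorVec_nonneg G) (informedLottery_nonneg σ))
  refine ⟨switchAt t₀ τB z, ?_⟩
  have h := eventually_average_le_expectedCav G σ τA (switchAt t₀ τB z) G.B Prod.snd Prod.snd
    Prod.snd hδ t₀ fun n hn h hU x => by
      simpa only [pushWeight_snd_opponentsLottery, switchAt, if_neg (not_lt.2 hn)] using hz n h hU x
  rw [expectedCav_congr (τB' := switchAt t₀ τB z) G σ τA τB G.B Prod.snd (fun n _ => rfl)
    fun n hn => funext fun h => if_pos hn] at h
  simpa only [betaAvgB_eq, neg_neg] using h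

variable {G σ τA τB}

lemma neg_betaA_le_expectedCav [Nonempty IA] [Nonempty JA] (hEq : IsUniformEquilibrium G σ τA τB)
    {β : ℝ} (hβ : Tendsto (fun T => betaAvgA G T σ τA τB) atTop (𝓝 β)) (t₀ : ℕ) :
    -β ≤ expectedCav G σ τA τB G.A Prod.fst t₀ := by
  refine le_of_forall_pos_le_add fun ε hε => ?_
  -- The deviation loses 3 · ε/6 over the expected concavified value and the equilibrium condition
  -- another ε/2, in total ε.
  obtain ⟨τA', hdev⟩ := exists_deviationA G σ τA τB (show 0 < ε / 6 by positivity) t₀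
  obtain ⟨T₀, -, hT₀⟩ := hEq.epsilon_nash (ε / 2) (by positivity)
  refine le_of_tendsto hβ.neg ?_
  filter_upwards [hdev, eventually_ge_atTop T₀] with T h1 h2
  have h3 := (hT₀ T h2).2.1 τA'
  linarith

lemma neg_betaB_le_expectedCav [Nonempty IB] [Nonempty JB] (hEq : IsUniformEquilibrium G σ τA τB)
    {β : ℝ} (hβ : Tendsto (fun T => betaAvgB G T σ τA τB) atTop (𝓝 β)) (t₀ : ℕ) :
    -β ≤ expectedCav G σ τA τB G.B Prod.snd t₀ := by
  refine le_of_forall_pos_le_add fun ε hε => ?_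
  obtain ⟨τB', hdev⟩ := exists_deviationB G σ τA τB (show 0 < ε / 6 by positivity) t₀
  obtain ⟨T₀, -, hT₀⟩ := hEq.epsilon_nash (ε / 2) (by positivity)
  refine le_of_tendsto hβ.neg ?_
  filter_upwards [hdev, eventually_ge_atTop T₀] with T h1 h2
  have h3 := (hT₀ T h2).2.2 τB'
  linarith

/-- The limit of the zero-sum identity for T-stage averages. States outside the support, where
convergence is not assumed, have prior weight zero. -/
lemma sum_priorVec_mul_eq_of_hasPayoffs {α : KA × KB → ℝ} {βA βB : ℝ}
    (h : HasPayoffs G σ τA τB α βA βB) : ∑ k, priorVec G k * α k = -(βA + βB) := by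
  have h1 : Tendsto (fun T => ∑ k, priorVec G k * alphaAvg G T k σ τA τB) atTop
      (𝓝 (∑ k, priorVec G k * α k)) := by
    refine tendsto_finsetSum _ fun k _ => ?_
    by_cases hk : k ∈ G.prior.support
    · exact (h.1 k hk).const_mul _
    · have : priorVec G k = 0 := by
        rw [PMF.mem_support_iff, not_not] at hk
        simp [priorVec, hk]
      simp [this]
  simp only [sum_priorVec_mul_alphaAvg] at h1
  exact tendsto_nhds_unique h1 (h.2.1.add h.2.2).neg

end Equilibrium

/-! ### The martingale of posteriors -/

section Posterior

variable {IA IB JA JB KA KB : Type*}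
  [Fintype IA] [MeasurableSpace IA] [DiscreteMeasurableSpace IA]
  [Fintype IB] [MeasurableSpace IB] [DiscreteMeasurableSpace IB]
  [Fintype JA] [MeasurableSpace JA] [DiscreteMeasurableSpace JA]
  [Fintype JB] [MeasurableSpace JB] [DiscreteMeasurableSpace JB]
  [Fintype KA] [MeasurableSpace KA] [DiscreteMeasurableSpace KA]
  [Fintype KB] [MeasurableSpace KB] [DiscreteMeasurableSpace KB]
  (G : Game IA IB JA JB KA KB) (σ : InformedStrategy IA IB JA JB KA KB)
  (τA : Strategy IA IB JA JB JA) (τB : Strategy IA IB JA JB JB)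

/-- Bayes' formula for the posterior after the history `h`. -/
def bayes (n : ℕ) (h : Hist IA IB JA JB n) (k : KA × KB) : ℝ :=
  stateWeight (priorVec G) (informedLottery σ) n h k /
    ∑ k', stateWeight (priorVec G) (informedLottery σ) n h k'

lemma exists_preimage_playPrefix_of_measurableSet {t : ℕ} {S : Set (Outcome IA IB JA JB KA KB)}
    (hS : MeasurableSet[histFiltration IA IB JA JB KA KB t] S) :
    ∃ S' : Set (Hist IA IB JA JB t), S = {ω | playPrefix t ω.1 ∈ S'} := by
  obtain ⟨S', -, rfl⟩ := hS
  exact ⟨S', rfl⟩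

open Classical in
lemma setIntegral_prefix {n : ℕ} (D : Set (Hist IA IB JA JB n))
    (f : Hist IA IB JA JB n × (KA × KB) → ℝ) :
    ∫ ω in {ω | playPrefix n ω.1 ∈ D}, f (playPrefix n ω.1, ω.2) ∂(outcomeLaw G σ τA τB) =
      ∑ h, if h ∈ D then oppWeight (opponentsLottery τA τB) n h *
        ∑ k, stateWeight (priorVec G) (informedLottery σ) n h k * f (h, k) else 0 := by
  have hD : MeasurableSet {ω : Outcome IA IB JA JB KA KB | playPrefix n ω.1 ∈ D} :=
    ((measurable_playPrefix n).comp measurable_fst) (MeasurableSet.of_discrete (s := D))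
  rw [← integral_indicator hD]
  have := integral_outcomeLaw_prefix G σ τA τB n fun x => if x.1 ∈ D then f x else 0
  refine Eq.trans ?_ (this.trans ?_)
  · refine integral_congr_ae (.of_forall fun ω => ?_)
    simp only [Set.indicator_apply, Set.mem_ofPred_eq]
  · refine Finset.sum_congr rfl fun h _ => ?_
    split_ifs <;> simp

lemma measurable_comp_playPrefix_histFiltration {Z : Type*} [MeasurableSpace Z] (t : ℕ)
    (f : Hist IA IB JA JB t → Z) :
    Measurable[histFiltration IA IB JA JB KA KB t]
      fun ω : Outcome IA IB JA JB KA KB => f (playPrefix t ω.1) :=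
  (Measurable.of_discrete (f := f)).comp (comap_measurable _)

/-- Events of the field are unions of finite histories, so the defining property of conditional
expectation reduces to: total weight times Bayes' quotient is the state weight. -/
lemma posterior_ae_eq_bayes (t : ℕ) :
    ∀ᵐ ω ∂(outcomeLaw G σ τA τB),
      posterior G σ τA τB t ω = bayes G σ t (playPrefix t ω.1) := by
  classical
  have hk : ∀ k, (fun ω : Outcome IA IB JA JB KA KB => bayes G σ t (playPrefix t ω.1) k)
      =ᵐ[outcomeLaw G σ τA τB] fun ω => posterior G σ τA τB t ω k := by
    intro k
    have hind : ({ω' : Outcome IA IB JA JB KA KB | ω'.2 = k}.indicator fun _ => (1 : ℝ)) =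
        fun ω => (fun x : Hist IA IB JA JB t × (KA × KB) => if x.2 = k then (1 : ℝ) else 0)
          (playPrefix t ω.1, ω.2) := by
      funext ω
      simp [Set.indicator_apply]
    have hint := integrable_comp_prefix_state G σ τA τB t fun x => bayes G σ t x.1 k
    refine ae_eq_condExp_of_forall_setIntegral_eq ((histFiltration IA IB JA JB KA KB).le t) ?_
      (fun _ _ _ => hint.integrableOn) (fun S hS _ => ?_)
      (measurable_comp_playPrefix_histFiltration t
        fun h => bayes G σ t h k).stronglyMeasurable.aestronglyMeasurable
    · rw [hind]
      exact integrable_comp_prefix_state G σ τA τB t fun x => if x.2 = k then (1 : ℝ) else 0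
    · obtain ⟨D, rfl⟩ := exists_preimage_playPrefix_of_measurableSet hS
      rw [hind, setIntegral_prefix, setIntegral_prefix G σ τA τB D fun x => bayes G σ t x.1 k]
      refine Finset.sum_congr rfl fun h _ => ?_
      congr 2
      simp only [mul_ite, mul_one, mul_zero, Finset.sum_ite_eq', Finset.mem_univ, if_true]
      rw [← Finset.sum_mul, bayes]
      -- Where the quotient has denominator zero, nonnegativity makes every state weight vanish.
      by_cases hU : ∑ k', stateWeight (priorVec G) (informedLottery σ) t h k' = 0
      · rw [hU, zero_mul, (Finset.sum_eq_zero_iff_of_nonneg fun k _ => stateWeight_nonneg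
          (priorVec_nonneg G) (informedLottery_nonneg σ) t h k).1 hU k (Finset.mem_univ k)]
      · field_simp
  filter_upwards [ae_all_iff.2 hk] with ω hω
  exact funext fun k => (hω k).symm

/-- Adaptedness must hold for the chosen version of the conditional expectation, which agrees with
Bayes' formula only almost everywhere. Factoring it through the finite set of histories gives this
without any regularity of `Cav`. -/
lemma exists_posterior_eq_comp_playPrefix (t : ℕ) :
    ∃ q : Hist IA IB JA JB t → KA × KB → ℝ,
      posterior G σ τA τB t = fun ω => q (playPrefix t ω.1) := by
  have hk : ∀ k, ∃ q : Hist IA IB JA JB t → ℝ, Measurable q ∧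
      (fun ω => posterior G σ τA τB t ω k) = q ∘ fun ω => playPrefix t ω.1 := fun k =>
    (stronglyMeasurable_condExp.measurable).exists_eq_measurable_comp
  choose q _ hq using hk
  exact ⟨fun h k => q k h, funext fun ω => funext fun k => congrFun (hq k) ω⟩

lemma sum_mul_comp_bayes {K' : Type*} [Fintype K'] (g : (K' → ℝ) → ℝ) (π : KA × KB → K') (n : ℕ)
    (h : Hist IA IB JA JB n) :
    ∑ k, stateWeight (priorVec G) (informedLottery σ) n h k * g (pushWeight π (bayes G σ n h)) =
      perspective g (pushWeight π (stateWeight (priorVec G) (informedLottery σ) n h)) := by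
  rw [← Finset.sum_mul, perspective, sum_pushWeight]
  congr 2
  funext a
  exact pushWeight_div π _ _ a

/-- If the expected concavified value of the posterior of `π` is constant in time, then the
concavified value of the posterior of `π` is a martingale. -/
lemma martingale_Cav_posterior {I' J' K' : Type*} [Fintype I'] [Fintype J'] [Fintype K']
    [Nonempty I'] [Nonempty J'] (M : K' → I' → J' → ℝ) (π : KA × KB → K')
    (hconst : ∀ n, expectedCav G σ τA τB M π (n + 1) = expectedCav G σ τA τB M π n) :
    Martingale (fun t ω => Cav (nonRevealingValue M) (pushWeight π (posterior G σ τA τB t ω)))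
      (histFiltration IA IB JA JB KA KB) (outcomeLaw G σ τA τB) := by
  classical
  set g := Cav (nonRevealingValue M) with hg
  set s := informedLottery σ with hs
  set y := opponentsLottery τA τB with hy
  obtain ⟨C, hC⟩ := exists_nonRevealingValue_le M
  have hae : ∀ t, (fun ω => g (pushWeight π (posterior G σ τA τB t ω))) =ᵐ[outcomeLaw G σ τA τB]
      fun ω => g (pushWeight π (bayes G σ t (playPrefix t ω.1))) := fun t => by
    filter_upwards [posterior_ae_eq_bayes G σ τA τB t] with ω hω
    rw [hω]
  -- The equality case: Jensen holds at each history and the sums over histories agree, so no term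
  -- can be strict.
  have hsplit : ∀ n (h : Hist IA IB JA JB n),
      oppWeight y n h * ∑ i, perspective g (pushWeight π
        fun k => stateWeight (priorVec G) s n h k * s k n h i) =
      oppWeight y n h * perspective g (pushWeight π (stateWeight (priorVec G) s n h)) := by
    intro n h
    have hle : ∀ h ∈ (Finset.univ : Finset (Hist IA IB JA JB n)),
        oppWeight y n h * ∑ i, perspective g (pushWeight π
          fun k => stateWeight (priorVec G) s n h k * s k n h i) ≤
        oppWeight y n h * perspective g (pushWeight π (stateWeight (priorVec G) s n h)) :=
      fun h _ => mul_le_mul_of_nonneg_left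
        (sum_perspective_pushWeight_le (concaveOn_Cav hC) π _ _
          (stateWeight_nonneg (priorVec_nonneg G) (informedLottery_nonneg σ) n h)
          (fun k i => informedLottery_nonneg σ k n h i) fun k => sum_informedLottery σ k n h)
        (oppWeight_nonneg (opponentsLottery_nonneg τA τB) n h)
    refine (Finset.sum_eq_sum_iff_of_le hle).1 ?_ h (Finset.mem_univ h)
    have := hconst n
    rwa [expectedCav, levelSum_succ (sum_opponentsLottery τA τB)] at this
  refine martingale_of_setIntegral_eq_succ (fun t => ?_) (fun t => ?_) fun t S hS => ?_
  · obtain ⟨q, hq⟩ := exists_posterior_eq_comp_playPrefix G σ τA τB t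
    simp only [hq]
    exact (measurable_comp_playPrefix_histFiltration t
      fun h => g (pushWeight π (q h))).stronglyMeasurable
  · exact (integrable_comp_prefix_state G σ τA τB t
      fun x => g (pushWeight π (bayes G σ t x.1))).congr (hae t).symm
  · rw [integral_congr_ae (ae_restrict_of_ae (hae t)),
      integral_congr_ae (ae_restrict_of_ae (hae (t + 1)))]
    obtain ⟨D, rfl⟩ := exists_preimage_playPrefix_of_measurableSet hS
    -- The event is rewritten in terms of t + 1 stages, so that both integrals become sums over
    -- histories of length t and can be compared term by term.
    have hD : {ω : Outcome IA IB JA JB KA KB | playPrefix t ω.1 ∈ D} =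
        {ω | playPrefix (t + 1) ω.1 ∈ {h : Hist IA IB JA JB (t + 1) | Fin.init h ∈ D}} := rfl
    rw [setIntegral_prefix G σ τA τB D fun x => g (pushWeight π (bayes G σ t x.1)), hD,
      setIntegral_prefix G σ τA τB _ fun x => g (pushWeight π (bayes G σ (t + 1) x.1)),
      sum_fin_succ_eq_sum_snoc]
    refine Finset.sum_congr rfl fun h _ => ?_
    simp only [Set.mem_ofPred_eq, Fin.init_snoc, sum_mul_comp_bayes]
    split_ifs with hh
    · rw [← hsplit]
      exact (sum_snoc_oppWeight_mul (sum_opponentsLottery τA τB)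
        (fun u => perspective g (pushWeight π u)) t h).symm
    · simp

end Posterior

end
end InfoSpillover

/-! ### The equality case at the maximal payoff -/

theorem theorem2 {IA IB JA JB KA KB : Type*}
    [Fintype IA] [MeasurableSpace IA] [DiscreteMeasurableSpace IA]
    [Fintype IB] [MeasurableSpace IB] [DiscreteMeasurableSpace IB]
    [Fintype JA] [MeasurableSpace JA] [DiscreteMeasurableSpace JA]
    [Fintype JB] [MeasurableSpace JB] [DiscreteMeasurableSpace JB]
    [Fintype KA] [MeasurableSpace KA] [DiscreteMeasurableSpace KA]
    [Fintype KB] [MeasurableSpace KB] [DiscreteMeasurableSpace KB]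
    (G : InfoSpillover.Game IA IB JA JB KA KB)
    (σ : InfoSpillover.InformedStrategy IA IB JA JB KA KB)
    (τA : InfoSpillover.Strategy IA IB JA JB JA)
    (τB : InfoSpillover.Strategy IA IB JA JB JB)
    (hEq : InfoSpillover.IsUniformEquilibrium G σ τA τB)
    (hPay : InfoSpillover.PaysExAnte G σ τA τB
      (InfoSpillover.Cav (InfoSpillover.nonRevealingValue G.A)
          (InfoSpillover.margA (InfoSpillover.priorVec G)) +
        InfoSpillover.Cav (InfoSpillover.nonRevealingValue G.B)
          (InfoSpillover.margB (InfoSpillover.priorVec G)))) :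
    Martingale
        (fun t ω => InfoSpillover.Cav (InfoSpillover.nonRevealingValue G.A)
          (InfoSpillover.margA (InfoSpillover.posterior G σ τA τB t ω)))
        (InfoSpillover.histFiltration IA IB JA JB KA KB)
        (InfoSpillover.outcomeLaw G σ τA τB) ∧
      Martingale
        (fun t ω => InfoSpillover.Cav (InfoSpillover.nonRevealingValue G.B)
          (InfoSpillover.margB (InfoSpillover.posterior G σ τA τB t ω)))
        (InfoSpillover.histFiltration IA IB JA JB KA KB)
        (InfoSpillover.outcomeLaw G σ τA τB) := by
  open InfoSpillover in
  -- The action sets are nonempty because lotteries on them exist.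
  obtain ⟨k, -⟩ := G.prior.support_nonempty
  obtain ⟨i, -⟩ := (σ k 0 Fin.elim0).support_nonempty
  obtain ⟨jA, -⟩ := (τA 0 Fin.elim0).support_nonempty
  obtain ⟨jB, -⟩ := (τB 0 Fin.elim0).support_nonempty
  have : Nonempty IA := ⟨i.1⟩
  have : Nonempty IB := ⟨i.2⟩
  have : Nonempty JA := ⟨jA⟩
  have : Nonempty JB := ⟨jB⟩
  obtain ⟨α, βA, βB, hP, hα⟩ := hPay
  simp only [margA_eq_pushWeight, margB_eq_pushWeight] at hα ⊢
  rw [sum_priorVec_mul_eq_of_hasPayoffs hP, ← expectedCav_zero G σ τA τB G.A,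
    ← expectedCav_zero G σ τA τB G.B] at hα
  have hA : ∀ n, expectedCav G σ τA τB G.A Prod.fst n ≤ expectedCav G σ τA τB G.A Prod.fst 0 :=
    fun n => antitone_nat_of_succ_le (expectedCav_succ_le G σ τA τB G.A Prod.fst) n.zero_le
  have hB : ∀ n, expectedCav G σ τA τB G.B Prod.snd n ≤ expectedCav G σ τA τB G.B Prod.snd 0 :=
    fun n => antitone_nat_of_succ_le (expectedCav_succ_le G σ τA τB G.B Prod.snd) n.zero_le
  have hβA := neg_betaA_le_expectedCav hEq hP.2.1
  have hβB := neg_betaB_le_expectedCav hEq hP.2.2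
  refine ⟨martingale_Cav_posterior G σ τA τB G.A Prod.fst fun n => ?_,
    martingale_Cav_posterior G σ τA τB G.B Prod.snd fun n => ?_⟩ <;>
  -- With c the expected concavified values, -βA ≤ c_A(n) ≤ c_A(0) and -βB ≤ c_B(n) ≤ c_B(0), while
  -- c_A(0) + c_B(0) = -(βA + βB); all these inequalities are equalities.
  linarith [hA n, hA (n + 1), hB n, hB (n + 1), hβA n, hβA (n + 1), hβB n, hβB (n + 1)]
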